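/- **Definitions.** A $k\times\ell$ grid $G=(P,Q)$ consists of a partition $P=(P_1,\dots,P_k)$ of the $y$-axis into $k$ nonempty intervals and a partition $Q=(Q_1,\dots,Q_\ell)$ of the $x$-axis into $\ell$ nonempty intervals; a grid on a rectangle $[x_0,x_1]\times[y_0,y_1]$ partitions $[y_0,y_1]$ and $[x_0,x_1]$ instead. For a joint distribution $\Pi$ of $(X,Y)$ put $p(i,j)=\Pr(X\in Q_j,\,Y\in P_i)$, and for a dataset $D$ of $n$ points of $\mathbb R^2$ let $p(i,j)$ be the fraction of points $(x,y)$ of $D$ with $x\in Q_j$, $y\in P_i$. In both cases let $$I^\star=\frac{1}{\log_2\min\{k,\ell\}}\sum_{i,j}p(i,j)\log_2\frac{p(i,j)}{p(i,*)\,p(*,j)},$$ where $p(i,*)$, $p(*,j)$ are the row and column sums and terms with $p(i,j)=0$ are $0$; write $I^\star(\Pi|_G)$, $I^\star(D|_G)$. Let $$\mathrm{MIC}_*(\Pi)=\sup_{k,\ell\ge2}\ \sup_{G}\ I^\star(\Pi|_G),$$ the inner supremum being over all $k\times\ell$ grids $G$ of the plane. Let $L=[x_0,x_1]\times[y_0,y_1]$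 and $c>0$. The size-$m$ range equipartition of an interval $[a,b]$ consists of the $m$ consecutive intervals of length $(b-a)/m$ (half-open on the right, the last one closed). For $2\le k\le\ell$ let $\mathcal R(L,c,k,\ell)$ be the set of $k\times\ell$ grids $(P,Q)$ on $L$ such that $Q$ is the size-$\ell$ range equipartition of $[x_0,x_1]$ and $P$ is a partition of $[y_0,y_1]$ into $k$ intervals each of which is a union of adjacent parts of the size-$\lfloor c\ell\rfloor$ range equipartition of $[y_0,y_1]$; for $k>\ell\ge2$ exchange the roles of the axes (so $P$ is the size-$k$ range equipartition of $[y_0,y_1]$ and $Q$ is an $\ell$-part coarsening of the size-$\lfloor ck\rfloor$ range equipartition of $[x_0,x_1]$). For a dataset $D$ of $n$ points in $L$ and $B=B(n)$, let $$\mathrm{MICr}(D,L,B,c)=\max_{k,\ell\ge2,\ k\ell\le B(n)}\ \max_{G\in\mathcal R(L,c,k,\ell)}I^\star(D|_G)$$ (a maximum over an empty set is $0$). For $n\ge4$ and $\epsilon>0$ let $\Delta_n=\frac{4\log_2 n}{n}+\frac6n$ and $$\mathrm{MICr\text{-}Lap}(D,L,B,c,\epsilon)=\big[\mathrm{MICr}(D,L,B,c)+Z\big]_{0,1},$$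 where $Z$ is independent of $D$ and has the zero-mean Laplace distribution with parameter $b=\Delta_n/\epsilon$ (density $e^{-|x|/b}/(2b)$), and $[x]_{0,1}=\max\{0,\min\{1,x\}\}$. **Theorem.** Let $L=[x_0,x_1]\times[y_0,y_1]$, let $c>0$ and $\epsilon>0$ be finite, let $\alpha\in(0,0.5)$, and let $B(n)\to\infty$ with $B(n)=O(n^\alpha)$. Then $\mathrm{MICr\text{-}Lap}(\cdot,L,B,c,\epsilon)$ is a consistent estimator of $\mathrm{MIC}_*$: for every joint distribution $\Pi$ of $(X,Y)$ with range bounded by $L$ (i.e. $\Pi(L)=1$), if $D_n$ is a dataset of $n$ points drawn i.i.d. from $\Pi$, then $$\mathrm{MICr\text{-}Lap}(D_n,L,B,c,\epsilon)\longrightarrow\mathrm{MIC}_*(\Pi)\quad\text{in probability as }n\to\infty .$$ Moreover, the Laplace scale $\Delta_n/\epsilon$ tends to $0$ as $n\to\infty$, and $\mathrm{MICr}(D_n,L,B,c)\to\mathrm{MIC}_*(\Pi)$ in probability for every such $\Pi$. -/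

import Mathlib

open MeasureTheory ProbabilityTheory Filter Topology Asymptotics

noncomputable section

namespace MICr

/-- `P 0, …, P (k-1)` is a partition of `I ⊆ ℝ` into `k` nonempty intervals, listed from left to
right. -/
structure IsIntervalPartition (I : Set ℝ) {k : ℕ} (P : Fin k → Set ℝ) : Prop where
  nonempty : ∀ i, (P i).Nonempty
  ordConnected : ∀ i, (P i).OrdConnected
  ordered : ∀ i j, i < j → ∀ x ∈ P i, ∀ y ∈ P j, x < y
  iUnion_eq : ⋃ i, P i = I

/-- `P` is a subpartition of `C`: every part of `P` is a union of adjacent parts of `C`. -/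
def IsSubpartition {k j : ℕ} (P : Fin k → Set ℝ) (C : Fin j → Set ℝ) : Prop :=
  ∀ i, ∃ a b : Fin j, P i = ⋃ t ∈ Set.Icc a b, C t

/-- The size-`m` range equipartition of `[a, b]`: parts of length `(b - a) / m`, closed on the
left and open on the right, except that the last part contains `b`. -/
def rangeEquipartition (a b : ℝ) (m : ℕ) : Fin m → Set ℝ := fun i =>
  if (i : ℕ) + 1 = m then Set.Icc (a + i * ((b - a) / m)) b
  else Set.Ico (a + i * ((b - a) / m)) (a + (i + 1) * ((b - a) / m))

/-- The size-`k` subpartitions of the size-`j` range equipartition of `[a, b]`. -/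
def subpartitions (a b : ℝ) (k j : ℕ) : Set (Fin k → Set ℝ) :=
  {P | IsIntervalPartition (Set.Icc a b) P ∧ IsSubpartition P (rangeEquipartition a b j)}

/-- A grid with `k` rows and `l` columns, given by its rows `P` (a list of subsets of the
`y`-axis) and its columns `Q` (a list of subsets of the `x`-axis). -/
structure Grid (k l : ℕ) where
  P : Fin k → Set ℝ
  Q : Fin l → Set ℝ

/-- All `k × l` grids on the plane. -/
def allGrids (k l : ℕ) : Set (Grid k l) :=
  {G | IsIntervalPartition Set.univ G.P ∧ IsIntervalPartition Set.univ G.Q}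

/-- The data of a range `L = [x₀, x₁] × [y₀, y₁]`. -/
structure Range where
  x₀ : ℝ
  x₁ : ℝ
  y₀ : ℝ
  y₁ : ℝ

/-- The range as a subset of the plane. -/
def Range.toSet (L : Range) : Set (ℝ × ℝ) := Set.Icc L.x₀ L.x₁ ×ˢ Set.Icc L.y₀ L.y₁

/-- The grids over which the `(k, l)` entry of the range equicharacteristic matrix is maximized:
the longer axis carries a range equipartition, the other one a subpartition of a range
equipartition `c` times as fine (`⌊c l⌋`, resp. `⌊c k⌋`, parts). -/
def rangeGrids (L : Range) (c : ℝ) (k l : ℕ) : Set (Grid k l) :=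
  if k ≤ l then
    {G | G.Q = rangeEquipartition L.x₀ L.x₁ l ∧ G.P ∈ subpartitions L.y₀ L.y₁ k ⌊c * l⌋₊}
  else
    {G | G.P = rangeEquipartition L.y₀ L.y₁ k ∧ G.Q ∈ subpartitions L.x₀ L.x₁ l ⌊c * k⌋₊}

/-- The discrete mutual information, in bits, of a `k × l` matrix of probabilities
(terms with `p i j = 0` vanish). -/
def mutualInfo {k l : ℕ} (p : Fin k → Fin l → ℝ) : ℝ :=
  ∑ i, ∑ j, p i j * Real.logb 2 (p i j / ((∑ j', p i j') * (∑ i', p i' j)))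

/-- The normalized mutual information. -/
def normalizedMI {k l : ℕ} (p : Fin k → Fin l → ℝ) : ℝ :=
  mutualInfo p / Real.logb 2 (min k l : ℕ)

/-- The normalized count matrix of a dataset of `n` points and a grid. -/
def countMatrix {n k l : ℕ} (D : Fin n → ℝ × ℝ) (G : Grid k l) : Fin k → Fin l → ℝ :=
  fun i j => ({t : Fin n | (D t).1 ∈ G.Q j ∧ (D t).2 ∈ G.P i}.ncard : ℝ) / n

/-- The matrix of cell probabilities of a joint distribution and a grid. -/
def probMatrix {k l : ℕ} (Pi : Measure (ℝ × ℝ)) (G : Grid k l) : Fin k → Fin l → ℝ :=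
  fun i j => Pi.real (G.Q j ×ˢ G.P i)

/-- The `(k, l)` entry of the characteristic matrix of a joint distribution. -/
def charEntry (Pi : Measure (ℝ × ℝ)) (k l : ℕ) : ℝ :=
  sSup ((fun G => normalizedMI (probMatrix Pi G)) '' allGrids k l)

/-- The population statistic `MIC*`. -/
def micStar (Pi : Measure (ℝ × ℝ)) : ℝ :=
  sSup {v | ∃ k l : ℕ, 2 ≤ k ∧ 2 ≤ l ∧ v = charEntry Pi k l}

/-- The `(k, l)` entry of the range equicharacteristic matrix of a dataset; it is `0` if there is
no grid to maximize over, that is, if `c` times the larger of `k, l` is too small. -/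
def rangeEntry (L : Range) (c : ℝ) {n : ℕ} (D : Fin n → ℝ × ℝ) (k l : ℕ) : ℝ :=
  sSup ((fun G => normalizedMI (countMatrix D G)) '' rangeGrids L c k l)

/-- The statistic `MICr(D, L, B, c)`, with `B` the value of the maximum grid size at `n`. -/
def micr (L : Range) (B c : ℝ) {n : ℕ} (D : Fin n → ℝ × ℝ) : ℝ :=
  sSup {v | ∃ k l : ℕ, 2 ≤ k ∧ 2 ≤ l ∧ (k : ℝ) * l ≤ B ∧ v = rangeEntry L c D k l}

/-- The zero-mean Laplace distribution with parameter `b > 0`. -/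
def laplace (b : ℝ) : Measure ℝ :=
  volume.withDensity fun x => ENNReal.ofReal (Real.exp (-|x| / b) / (2 * b))

/-- The parameter `Δ / ε`, `Δ = (4 log₂ n) / n + 6 / n`, of the noise of `MICr-Lap`. -/
def noiseScale (n : ℕ) (ε : ℝ) : ℝ := (4 * Real.logb 2 n / n + 6 / n) / ε

/-- Truncation to `[0, 1]`. -/
def truncate (x : ℝ) : ℝ := max 0 (min 1 x)

/-- The output of `MICr-Lap(D, L, B, c, ε)` when the noise takes the value `z`; the mechanism
draws `z` from `laplace (noiseScale n ε)`, independently of the dataset. -/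
def micrLap (L : Range) (B c : ℝ) {n : ℕ} (D : Fin n → ℝ × ℝ) (z : ℝ) : ℝ :=
  truncate (micr L B c D + z)

end MICr

end

/-! Upper bound: a range grid extends to a grid of the plane with the same cell probabilities under
a distribution carried by `L`, so its population score is at most `MIC*`. Lower bound: a `k × l`
grid with `k ≤ l` is a pointwise limit on `L` of grids whose rows and columns are unions of
equipartition cells. By dominated convergence and continuity of mutual information the scores
converge. Undoing the merging of columns does not lower mutual information, and the normalizer stays
`log k`, so some range grid with `k` rows scores almost as much (`exists_mem_rangeGrids_gt_of_le`).
Since `B n → ∞`, this fixed grid is eventually admissible.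

The sample must then be close to the population uniformly over admissible range grids. Every union
of cells of such a grid is a union of cells of one of `O(B)` fixed equipartition grids with `O(B²)`
cells each. Hoeffding and a union bound over all these unions bound the failure probability by `4
exp((1 + c) B² - 2 n t²)` (`measure_not_isTypical_le`). On the complement the cell probabilities are
within `2t` in `ℓ¹`, and the modulus of continuity of entropy gives a score error of order `t log n
+ B / n` (`IsTypical.abs_sub_le`). Because `B² = O(n ^ (2α))` with `2α < 1`, some `t = n ^ (-s)`
sends both bounds to zero.

For the private version, the Laplace scale tends to zero, so the noise vanishes in probability;
clamping to `[0, 1]` does no harm because `MIC*` lies there. -/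

namespace MICr

/-! ### Log-sum inequality and modulus of continuity of `-x log x` -/

open Finset in
/-- The log-sum inequality. -/
theorem log_sum_inequality {ι : Type*} (s : Finset ι) (p w : ι → ℝ) (hp : ∀ i ∈ s, 0 ≤ p i)
    (hw : ∀ i ∈ s, 0 ≤ w i) (hpw : ∀ i ∈ s, 0 < p i → 0 < w i) :
    (∑ i ∈ s, p i) * Real.log ((∑ i ∈ s, p i) / ∑ i ∈ s, w i) ≤
      ∑ i ∈ s, p i * Real.log (p i / w i) := by
  rcases (sum_nonneg hp).eq_or_lt with hP | hP
  · have h0 := (sum_eq_zero_iff_of_nonneg hp).1 hP.symm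
    rw [← hP, zero_mul, sum_eq_zero fun i hi => by rw [h0 i hi, zero_mul]]
  obtain ⟨i₀, hi₀, hpi₀⟩ := exists_lt_of_sum_lt (s := s) (f := fun _ => (0 : ℝ)) (g := p)
    (by simpa using hP)
  have hW : 0 < ∑ i ∈ s, w i := sum_pos' hw ⟨i₀, hi₀, hpw i₀ hi₀ hpi₀⟩
  set P := ∑ i ∈ s, p i with hPdef
  set W := ∑ i ∈ s, w i with hWdef
  have key : ∀ i ∈ s, p i * Real.log (P / W) + (p i - w i * (P / W)) ≤
      p i * Real.log (p i / w i) := by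
    intro i hi
    rcases (hp i hi).eq_or_lt with h | h
    · rw [← h]
      have := mul_nonneg (hw i hi) (div_pos hP hW).le
      simp only [zero_mul]
      linarith
    · have hwi := hpw i hi h
      have h1 := Real.one_sub_inv_le_log_of_pos (x := (p i / w i) / (P / W)) (by positivity)
      rw [Real.log_div (by positivity) (by positivity)] at h1
      have h2 := mul_le_mul_of_nonneg_left h1 h.le
      have h3 : p i * (1 - ((p i / w i) / (P / W))⁻¹) = p i - w i * (P / W) := by
        field_simp
      rw [h3] at h2
      linarith
  have h4 := sum_le_sum key
  rw [sum_add_distrib, sum_sub_distrib, ← sum_mul, ← sum_mul, ← hPdef, ← hWdef,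
    mul_div_cancel₀ _ hW.ne'] at h4
  linarith

/-- By concavity the graph lies below its tangent at `1 / K`; the term `-d` of the tangent is
dropped. -/
theorem negMulLog_le_mul_log_add_inv {K d : ℝ} (hK : 0 < K) (hd : 0 ≤ d) :
    Real.negMulLog d ≤ d * Real.log K + 1 / K := by
  rcases hd.eq_or_lt with rfl | hd
  · simp [hK.le]
  have h := Real.one_sub_inv_le_log_of_pos (x := K * d) (by positivity)
  rw [Real.log_mul hK.ne' hd.ne'] at h
  have h2 := mul_le_mul_of_nonneg_left h hd.le
  have h3 : d * (1 - (K * d)⁻¹) = d - 1 / K := by field_simp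
  rw [h3] at h2
  rw [Real.negMulLog]
  linarith

/-- `-x log x` is not Lipschitz at `0`; a Lipschitz constant `1 + log K` is bought at an additive
cost `1 / K`. With `x = y + d`, the increase is at most `-d log d` by subadditivity, and the
decrease at most `d` by `log (x / y) ≤ x / y - 1`. -/
theorem abs_negMulLog_sub_le_of_le {K x y : ℝ} (hK : 1 ≤ K) (hy : 0 ≤ y) (hyx : y ≤ x)
    (hx : x ≤ 1) :
    |Real.negMulLog x - Real.negMulLog y| ≤ |x - y| * (1 + Real.log K) + 1 / K := by
  have hK0 : 0 < K := by linarith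
  have hlogK := Real.log_nonneg hK
  have hKinv : 0 < 1 / K := by positivity
  obtain ⟨d, rfl⟩ : ∃ d, x = y + d := ⟨x - y, by ring⟩
  have hd : 0 ≤ d := by linarith
  have habs : |y + d - y| = d := by rw [add_sub_cancel_left, abs_of_nonneg hd]
  rw [habs]
  have hη := negMulLog_le_mul_log_add_inv hK0 hd
  rcases hd.eq_or_lt with rfl | hd
  · simp [hK0.le]
  rw [abs_le]
  simp only [Real.negMulLog] at *
  have hdl : Real.log d ≤ Real.log (y + d) := Real.log_le_log hd (by linarith)
  have hxl : Real.log (y + d) ≤ 0 := Real.log_nonpos (by linarith) hx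
  have hdK := mul_nonneg hd.le hlogK
  rcases hy.eq_or_lt with rfl | hy
  · simp only [zero_add, Real.log_zero, mul_zero, sub_zero] at *
    constructor <;> nlinarith
  have hyl : Real.log y ≤ Real.log (y + d) := Real.log_le_log hy (by linarith)
  constructor
  · have h := Real.log_le_sub_one_of_pos (x := (y + d) / y) (by positivity)
    rw [Real.log_div (by positivity) hy.ne'] at h
    have h2 := mul_le_mul_of_nonneg_left h hy.le
    have h3 : y * ((y + d) / y - 1) = d := by field_simp; ring
    rw [h3] at h2
    nlinarith
  · nlinarith

theorem abs_negMulLog_sub_le {K x y : ℝ} (hK : 1 ≤ K) (hx : 0 ≤ x) (hx1 : x ≤ 1) (hy : 0 ≤ y)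
    (hy1 : y ≤ 1) :
    |Real.negMulLog x - Real.negMulLog y| ≤ |x - y| * (1 + Real.log K) + 1 / K := by
  rcases le_total y x with h | h
  · exact abs_negMulLog_sub_le_of_le hK hy h hx1
  · rw [abs_sub_comm, abs_sub_comm x]
    exact abs_negMulLog_sub_le_of_le hK hx h hy1

theorem abs_sum_negMulLog_sub_le {ι : Type*} [Fintype ι] {K : ℝ} (hK : 1 ≤ K) (p q : ι → ℝ)
    (hp : ∀ i, 0 ≤ p i) (hp1 : ∀ i, p i ≤ 1) (hq : ∀ i, 0 ≤ q i) (hq1 : ∀ i, q i ≤ 1) :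
    |∑ i, Real.negMulLog (p i) - ∑ i, Real.negMulLog (q i)| ≤
      (∑ i, |p i - q i|) * (1 + Real.log K) + Fintype.card ι / K := by
  rw [← Finset.sum_sub_distrib]
  refine (Finset.abs_sum_le_sum_abs _ _).trans ((Finset.sum_le_sum fun i _ =>
    abs_negMulLog_sub_le hK (hp i) (hp1 i) (hq i) (hq1 i)).trans_eq ?_)
  rw [Finset.sum_add_distrib, ← Finset.sum_mul, Finset.sum_const, Finset.card_univ, nsmul_eq_mul,
    mul_one_div]

/-! ### Mutual information of finite matrices: monotonicity, bounds, continuity -/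

section MutualInfo

variable {k l : ℕ}

theorem mutualInfo_mul_log (p : Fin k → Fin l → ℝ) :
    mutualInfo p * Real.log 2 =
      ∑ i, ∑ j, p i j * Real.log (p i j / ((∑ j', p i j') * (∑ i', p i' j))) := by
  have h2 : Real.log 2 ≠ 0 := (Real.log_pos one_lt_two).ne'
  simp only [mutualInfo, Finset.sum_mul, mul_assoc, Real.logb, div_mul_cancel₀ _ h2]

theorem le_rowSum {p : Fin k → Fin l → ℝ} (hp : ∀ i j, 0 ≤ p i j) (i : Fin k) (j : Fin l) :
    p i j ≤ ∑ j', p i j' :=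
  Finset.single_le_sum (f := fun j' => p i j') (fun j' _ => hp i j') (Finset.mem_univ j)

theorem le_colSum {p : Fin k → Fin l → ℝ} (hp : ∀ i j, 0 ≤ p i j) (i : Fin k) (j : Fin l) :
    p i j ≤ ∑ i', p i' j :=
  Finset.single_le_sum (f := fun i' => p i' j) (fun i' _ => hp i' j) (Finset.mem_univ i)

/-- No normalization of the total mass is needed. This form reduces continuity and `ℓ¹` estimates to
those of `-x log x`. -/
theorem mutualInfo_mul_log_eq_entropy (p : Fin k → Fin l → ℝ) (hp : ∀ i j, 0 ≤ p i j) :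
    mutualInfo p * Real.log 2 =
      ∑ i, Real.negMulLog (∑ j, p i j) + ∑ j, Real.negMulLog (∑ i, p i j) -
        ∑ ij : Fin k × Fin l, Real.negMulLog (p ij.1 ij.2) := by
  rw [mutualInfo_mul_log, Fintype.sum_prod_type]
  have h : ∀ i j, p i j * Real.log (p i j / ((∑ j', p i j') * (∑ i', p i' j))) =
      -(p i j * Real.log (∑ j', p i j')) + -(p i j * Real.log (∑ i', p i' j)) -
        Real.negMulLog (p i j) := by
    intro i j
    rcases (hp i j).eq_or_lt with h | h
    · simp [← h]
    have hr := h.trans_le (le_rowSum hp i j)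
    have hc := h.trans_le (le_colSum hp i j)
    rw [Real.log_div h.ne' (by positivity), Real.log_mul hr.ne' hc.ne', Real.negMulLog]
    ring
  simp only [h, Finset.sum_sub_distrib, Finset.sum_add_distrib]
  congr 2
  · simp only [Finset.sum_neg_distrib, ← Finset.sum_mul, Real.negMulLog, neg_mul]
  · rw [Finset.sum_comm]
    simp only [Finset.sum_neg_distrib, ← Finset.sum_mul, Real.negMulLog, neg_mul]

theorem mutualInfo_transpose (p : Fin k → Fin l → ℝ) :
    mutualInfo (fun j i => p i j) = mutualInfo p := by
  rw [mutualInfo, mutualInfo, Finset.sum_comm]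
  simp only [mul_comm]

theorem normalizedMI_transpose (p : Fin k → Fin l → ℝ) :
    normalizedMI (fun j i => p i j) = normalizedMI p := by
  rw [normalizedMI, normalizedMI, mutualInfo_transpose, min_comm]

/-- Merging rows along `φ` and columns along `ψ` does not increase the mutual information. -/
theorem mutualInfo_merge_le {k' l' : ℕ} (p : Fin k → Fin l → ℝ) (hp : ∀ i j, 0 ≤ p i j)
    (φ : Fin k → Fin k') (ψ : Fin l → Fin l') :
    mutualInfo (fun a b => ∑ i with φ i = a, ∑ j with ψ j = b, p i j) ≤ mutualInfo p := by
  have h2 := Real.log_pos one_lt_two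
  rw [← mul_le_mul_iff_left₀ h2, mutualInfo_mul_log, mutualInfo_mul_log]
  have hr : ∀ a, ∑ b, ∑ i with φ i = a, ∑ j with ψ j = b, p i j =
      ∑ i with φ i = a, ∑ j, p i j := by
    intro a
    rw [Finset.sum_comm]
    exact Finset.sum_congr rfl fun i _ => Finset.sum_fiberwise Finset.univ ψ (p i)
  have hc : ∀ b, ∑ a, ∑ i with φ i = a, ∑ j with ψ j = b, p i j =
      ∑ j with ψ j = b, ∑ i, p i j := by
    intro b
    rw [Finset.sum_fiberwise, Finset.sum_comm]
  simp only [hr, hc]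
  have hR : ∑ i, ∑ j, p i j * Real.log (p i j / ((∑ j', p i j') * (∑ i', p i' j))) =
      ∑ a, ∑ b, ∑ i with φ i = a, ∑ j with ψ j = b,
        p i j * Real.log (p i j / ((∑ j', p i j') * (∑ i', p i' j))) := by
    rw [← Finset.sum_fiberwise Finset.univ φ]
    refine Finset.sum_congr rfl fun a _ => ?_
    refine Eq.trans ?_ Finset.sum_comm
    exact Finset.sum_congr rfl fun i _ => (Finset.sum_fiberwise Finset.univ ψ
      fun j => p i j * Real.log (p i j / ((∑ j', p i j') * (∑ i', p i' j)))).symm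
  rw [hR]
  refine Finset.sum_le_sum fun a _ => Finset.sum_le_sum fun b _ => ?_
  have := log_sum_inequality
    ((Finset.univ.filter fun i => φ i = a) ×ˢ (Finset.univ.filter fun j => ψ j = b))
    (fun ij => p ij.1 ij.2) (fun ij => (∑ j', p ij.1 j') * (∑ i', p i' ij.2))
    (fun ij _ => hp _ _)
    (fun ij _ => mul_nonneg (Finset.sum_nonneg fun _ _ => hp _ _)
      (Finset.sum_nonneg fun _ _ => hp _ _))
    (fun ij _ h => mul_pos (h.trans_le (le_rowSum hp _ _)) (h.trans_le (le_colSum hp _ _)))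
  simpa only [Finset.sum_product, Finset.sum_mul_sum] using this

/-- Merging everything into one cell of mass `s ≤ 1` leaves `-s log s ≥ 0`. Mass below one is
allowed because data may lie outside the grid. -/
theorem mutualInfo_nonneg (p : Fin k → Fin l → ℝ) (hp : ∀ i j, 0 ≤ p i j)
    (h1 : ∑ i, ∑ j, p i j ≤ 1) : 0 ≤ mutualInfo p := by
  have h2 := Real.log_pos one_lt_two
  refine le_trans ?_ (mutualInfo_merge_le p hp (fun _ => (0 : Fin 1)) (fun _ => (0 : Fin 1)))
  have h0 : 0 ≤ ∑ i, ∑ j, p i j := Finset.sum_nonneg fun i _ => Finset.sum_nonneg fun j _ => hp i j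
  simp only [mutualInfo, Finset.univ_unique, Finset.sum_singleton, Fin.default_eq_zero,
    Finset.filter_true]
  rcases h0.eq_or_lt with h | h
  · rw [← h, zero_mul]
  · refine mul_nonneg h0 (Real.logb_nonneg one_lt_two ?_)
    rw [le_div_iff₀ (by positivity)]
    nlinarith

/-- The mutual information is at most the entropy of the rows. -/
theorem mutualInfo_mul_log_le_entropy (p : Fin k → Fin l → ℝ) (hp : ∀ i j, 0 ≤ p i j) :
    mutualInfo p * Real.log 2 ≤ ∑ i, Real.negMulLog (∑ j, p i j) := by
  rw [mutualInfo_mul_log]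
  refine Finset.sum_le_sum fun i _ => ?_
  rw [Real.negMulLog, neg_mul, Finset.sum_mul, ← Finset.sum_neg_distrib]
  refine Finset.sum_le_sum fun j _ => ?_
  rcases (hp i j).eq_or_lt with h | h
  · simp [← h]
  have hr := h.trans_le (le_rowSum hp i j)
  have hc := h.trans_le (le_colSum hp i j)
  rw [← mul_neg, ← Real.log_inv]
  refine mul_le_mul_of_nonneg_left (Real.log_le_log (by positivity) ?_) h.le
  rw [inv_eq_one_div, div_le_div_iff₀ (by positivity) hr]
  nlinarith [le_colSum hp i j]

theorem mutualInfo_le_logb (p : Fin k → Fin l → ℝ) (hp : ∀ i j, 0 ≤ p i j)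
    (h1 : ∑ i, ∑ j, p i j = 1) : mutualInfo p ≤ Real.logb 2 k := by
  have h2 := Real.log_pos one_lt_two
  rw [Real.logb, le_div_iff₀ h2]
  refine (mutualInfo_mul_log_le_entropy p hp).trans ?_
  have := log_sum_inequality Finset.univ (fun i => ∑ j, p i j) (fun _ => (1 : ℝ))
    (fun i _ => Finset.sum_nonneg fun j _ => hp i j) (by simp) (by simp)
  simp only [h1, Finset.sum_const, Finset.card_univ, Fintype.card_fin, nsmul_eq_mul, mul_one,
    one_mul, div_one, one_div, Real.log_inv] at this
  simp only [Real.negMulLog, neg_mul, Finset.sum_neg_distrib]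
  linarith

theorem one_le_logb_min (hk : 2 ≤ k) (hl : 2 ≤ l) : 1 ≤ Real.logb 2 (min k l : ℕ) := by
  rw [Real.le_logb_iff_rpow_le one_lt_two (by positivity), Real.rpow_one]
  exact_mod_cast le_min hk hl

theorem normalizedMI_nonneg (hk : 2 ≤ k) (hl : 2 ≤ l) (p : Fin k → Fin l → ℝ)
    (hp : ∀ i j, 0 ≤ p i j) (h1 : ∑ i, ∑ j, p i j ≤ 1) : 0 ≤ normalizedMI p :=
  div_nonneg (mutualInfo_nonneg p hp h1) (zero_le_one.trans (one_le_logb_min hk hl))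

theorem normalizedMI_le_one (hk : 2 ≤ k) (hl : 2 ≤ l) (p : Fin k → Fin l → ℝ)
    (hp : ∀ i j, 0 ≤ p i j) (h1 : ∑ i, ∑ j, p i j = 1) : normalizedMI p ≤ 1 := by
  have h := one_le_logb_min hk hl
  rw [normalizedMI, div_le_one (by linarith)]
  rcases le_total k l with hkl | hkl
  · rw [min_eq_left hkl]
    exact mutualInfo_le_logb p hp h1
  · rw [min_eq_right hkl, ← mutualInfo_transpose]
    exact mutualInfo_le_logb _ (fun j i => hp i j) (by rw [Finset.sum_comm]; exact h1)

/-- Each of the three entropies contributes one modulus of continuity: passing to marginals does not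
increase `ℓ¹` distance, and the additive costs count `k`, `l` and `k * l` atoms. -/
theorem abs_mutualInfo_sub_le {K t : ℝ} (hK : 1 ≤ K) (p q : Fin k → Fin l → ℝ)
    (hp : ∀ i j, 0 ≤ p i j) (hp1 : ∑ i, ∑ j, p i j ≤ 1)
    (hq : ∀ i j, 0 ≤ q i j) (hq1 : ∑ i, ∑ j, q i j ≤ 1)
    (ht : ∑ i, ∑ j, |p i j - q i j| ≤ t) :
    |mutualInfo p - mutualInfo q| * Real.log 2 ≤
      3 * (t * (1 + Real.log K)) + (k + l + k * l) / K := by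
  have hlogK := Real.log_nonneg hK
  have h2 := Real.log_pos one_lt_two
  have row1 : ∀ {r : Fin k → Fin l → ℝ}, (∀ i j, 0 ≤ r i j) → ∑ i, ∑ j, r i j ≤ 1 →
      ∀ i, ∑ j, r i j ≤ 1 := fun {r} hr hr1 i =>
    (Finset.single_le_sum (f := fun i => ∑ j, r i j)
      (fun i _ => Finset.sum_nonneg fun j _ => hr i j) (Finset.mem_univ i)).trans hr1
  have col1 : ∀ {r : Fin k → Fin l → ℝ}, (∀ i j, 0 ≤ r i j) → ∑ i, ∑ j, r i j ≤ 1 →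
      ∀ j, ∑ i, r i j ≤ 1 := fun {r} hr hr1 j =>
    (Finset.single_le_sum (f := fun j => ∑ i, r i j)
      (fun j _ => Finset.sum_nonneg fun i _ => hr i j) (Finset.mem_univ j)).trans
        (by rw [Finset.sum_comm]; exact hr1)
  have hR := abs_sum_negMulLog_sub_le hK (fun i => ∑ j, p i j) (fun i => ∑ j, q i j)
    (fun i => Finset.sum_nonneg fun j _ => hp i j) (row1 hp hp1)
    (fun i => Finset.sum_nonneg fun j _ => hq i j) (row1 hq hq1)
  have hC := abs_sum_negMulLog_sub_le hK (fun j => ∑ i, p i j) (fun j => ∑ i, q i j)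
    (fun j => Finset.sum_nonneg fun i _ => hp i j) (col1 hp hp1)
    (fun j => Finset.sum_nonneg fun i _ => hq i j) (col1 hq hq1)
  have hJ := abs_sum_negMulLog_sub_le hK (fun ij : Fin k × Fin l => p ij.1 ij.2)
    (fun ij => q ij.1 ij.2) (fun ij => hp _ _)
    (fun ij => (le_rowSum hp _ _).trans (row1 hp hp1 _)) (fun ij => hq _ _)
    (fun ij => (le_rowSum hq _ _).trans (row1 hq hq1 _))
  have tR : ∑ i, |∑ j, p i j - ∑ j, q i j| ≤ t := le_trans (Finset.sum_le_sum fun i _ => by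
    rw [← Finset.sum_sub_distrib]; exact Finset.abs_sum_le_sum_abs _ _) ht
  have tC : ∑ j, |∑ i, p i j - ∑ i, q i j| ≤ t := by
    rw [Finset.sum_comm] at ht
    refine le_trans (Finset.sum_le_sum fun j _ => ?_) ht
    rw [← Finset.sum_sub_distrib]; exact Finset.abs_sum_le_sum_abs _ _
  have tJ : ∑ ij : Fin k × Fin l, |p ij.1 ij.2 - q ij.1 ij.2| ≤ t := by
    rwa [Fintype.sum_prod_type]
  have hpos : 0 ≤ 1 + Real.log K := by linarith
  have tR' := mul_le_mul_of_nonneg_right tR hpos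
  have tC' := mul_le_mul_of_nonneg_right tC hpos
  have tJ' := mul_le_mul_of_nonneg_right tJ hpos
  have habs : |mutualInfo p - mutualInfo q| * Real.log 2 =
      |(mutualInfo p - mutualInfo q) * Real.log 2| := by rw [abs_mul, abs_of_pos h2]
  rw [habs, sub_mul, mutualInfo_mul_log_eq_entropy p hp,
    mutualInfo_mul_log_eq_entropy q hq]
  simp only [Fintype.card_fin, Fintype.card_prod, Nat.cast_mul] at hR hC hJ
  have hsplit : ((k : ℝ) + l + k * l) / K = k / K + l / K + k * l / K := by ring
  rw [hsplit, abs_le]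
  rw [abs_le] at hR hC hJ
  constructor <;> linarith

theorem continuousOn_mutualInfo :
    ContinuousOn (mutualInfo (k := k) (l := l)) {p | ∀ i j, 0 ≤ p i j} := by
  have h2 := Real.log_pos one_lt_two
  have : ContinuousOn (fun p : Fin k → Fin l → ℝ => (∑ i, Real.negMulLog (∑ j, p i j) +
      ∑ j, Real.negMulLog (∑ i, p i j) -
        ∑ ij : Fin k × Fin l, Real.negMulLog (p ij.1 ij.2)) / Real.log 2)
      {p | ∀ i j, 0 ≤ p i j} := by
    have := Real.continuous_negMulLog
    fun_prop
  refine this.congr fun p hp => ?_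
  rw [eq_div_iff h2.ne', mutualInfo_mul_log_eq_entropy p hp]

end MutualInfo

/-! ### Interval partitions and range equipartitions -/

section Partition

theorem IsIntervalPartition.eq_of_mem {I : Set ℝ} {k : ℕ} {P : Fin k → Set ℝ}
    (hP : IsIntervalPartition I P) {i j : Fin k} {x : ℝ} (hi : x ∈ P i) (hj : x ∈ P j) :
    i = j := by
  rcases lt_trichotomy i j with h | h | h
  · exact absurd (hP.ordered i j h x hi x hj) (lt_irrefl x)
  · exact h
  · exact absurd (hP.ordered j i h x hj x hi) (lt_irrefl x)

/-- An interval partition of `[a, b]` extends to the whole line. -/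
theorem IsIntervalPartition.exists_extension {a b : ℝ} (hab : a ≤ b) {k : ℕ} {P : Fin k → Set ℝ}
    (hP : IsIntervalPartition (Set.Icc a b) P) :
    ∃ P' : Fin k → Set ℝ, IsIntervalPartition Set.univ P' ∧
      ∀ i, ∀ x ∈ Set.Icc a b, x ∈ P' i ↔ x ∈ P i := by
  -- The extension is the pullback under clamping to `[a, b]`, so the extreme parts absorb the
  -- half-lines.
  have hmono : Monotone fun x => max a (min b x) := fun x y h =>
    max_le_max le_rfl (min_le_min le_rfl h)
  have hid : ∀ x ∈ Set.Icc a b, max a (min b x) = x := fun x hx => by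
    rw [min_eq_right hx.2, max_eq_right hx.1]
  have hsub : ∀ i, P i ⊆ Set.Icc a b := fun i => hP.iUnion_eq ▸ Set.subset_iUnion P i
  refine ⟨fun i => (fun x => max a (min b x)) ⁻¹' P i, ⟨fun i => ?_, fun i => ?_, ?_, ?_⟩, ?_⟩
  · obtain ⟨x, hx⟩ := hP.nonempty i
    exact ⟨x, by rwa [Set.mem_preimage, hid x (hsub i hx)]⟩
  · exact (hP.ordConnected i).preimage_mono hmono
  · intro i j hij x hx y hy
    exact hmono.reflect_lt (hP.ordered i j hij _ hx _ hy)
  · rw [← Set.preimage_iUnion, hP.iUnion_eq]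
    exact Set.eq_univ_of_forall fun x => ⟨le_max_left _ _, max_le hab (min_le_left _ _)⟩
  · intro i x hx
    rw [Set.mem_preimage, hid x hx]

theorem ordConnected_rangeEquipartition (a b : ℝ) (m : ℕ) (i : Fin m) :
    (rangeEquipartition a b m i).OrdConnected := by
  rw [rangeEquipartition]
  split_ifs
  exacts [Set.ordConnected_Icc, Set.ordConnected_Ico]

theorem mem_rangeEquipartition_lower {a b x : ℝ} {m : ℕ} {i : Fin m}
    (hx : x ∈ rangeEquipartition a b m i) : a + i * ((b - a) / m) ≤ x := by
  rw [rangeEquipartition] at hx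
  split_ifs at hx
  exacts [hx.1, hx.1]

theorem mem_rangeEquipartition_upper {a b x : ℝ} {m : ℕ} {i : Fin m}
    (hx : x ∈ rangeEquipartition a b m i) : x ≤ a + (i + 1) * ((b - a) / m) := by
  rw [rangeEquipartition] at hx
  split_ifs at hx with h
  · refine hx.2.trans_eq ?_
    have hm : (m : ℝ) ≠ 0 := by
      have := i.pos
      positivity
    have h' : ((i : ℕ) : ℝ) + 1 = m := by exact_mod_cast h
    rw [h']
    field_simp
    ring
  · exact hx.2.le

theorem rangeEquipartition_ordered {a b : ℝ} (hab : a ≤ b) {m : ℕ} {i j : Fin m} (hij : i < j)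
    {x y : ℝ} (hx : x ∈ rangeEquipartition a b m i) (hy : y ∈ rangeEquipartition a b m j) :
    x < y := by
  have hy' := mem_rangeEquipartition_lower hy
  rw [rangeEquipartition, if_neg (by have := j.2; have : (i : ℕ) < j := hij; omega)] at hx
  refine hx.2.trans_le (le_trans ?_ hy')
  have h1 : ((i : ℕ) : ℝ) + 1 ≤ (j : ℕ) := by exact_mod_cast hij
  have h2 : 0 ≤ (b - a) / m := div_nonneg (by linarith) (by positivity)
  nlinarith

theorem rangeEquipartition_eq_of_mem {a b : ℝ} (hab : a ≤ b) {m : ℕ} {i j : Fin m} {x : ℝ}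
    (hx : x ∈ rangeEquipartition a b m i) (hy : x ∈ rangeEquipartition a b m j) : i = j := by
  rcases lt_trichotomy i j with h | h | h
  · exact absurd (rangeEquipartition_ordered hab h hx hy) (lt_irrefl x)
  · exact h
  · exact absurd (rangeEquipartition_ordered hab h hy hx) (lt_irrefl x)

theorem isIntervalPartition_rangeEquipartition {a b : ℝ} (hab : a < b) {m : ℕ} (hm : 0 < m) :
    IsIntervalPartition (Set.Icc a b) (rangeEquipartition a b m) := by
  have hm' : (0 : ℝ) < m := by exact_mod_cast hm
  have hh : 0 < (b - a) / m := div_pos (by linarith) hm'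
  have hmh : (m : ℝ) * ((b - a) / m) = b - a := by field_simp
  have hle : ∀ i : Fin m, ((i : ℕ) : ℝ) + 1 ≤ m := fun i => by exact_mod_cast i.2
  refine ⟨fun i => ⟨a + i * ((b - a) / m), ?_⟩, ordConnected_rangeEquipartition a b m,
    fun i j hij x hx y hy => rangeEquipartition_ordered hab.le hij hx hy, ?_⟩
  · have := hle i
    rw [rangeEquipartition]
    split_ifs
    · exact ⟨le_rfl, by nlinarith⟩
    · exact ⟨le_rfl, by nlinarith⟩
  · refine Set.Subset.antisymm (Set.iUnion_subset fun i x hx => ?_) fun x hx => ?_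
    · have h1 := mem_rangeEquipartition_lower hx
      have h2 := mem_rangeEquipartition_upper hx
      have := hle i
      have h3 : (0 : ℝ) ≤ (i : ℕ) := by positivity
      exact ⟨by nlinarith, by nlinarith⟩
    · rw [Set.mem_iUnion]
      have hx0 : 0 ≤ (x - a) / ((b - a) / m) := div_nonneg (by linarith [hx.1]) hh.le
      have hfl := Nat.floor_le hx0
      have hfu := Nat.lt_floor_add_one ((x - a) / ((b - a) / m))
      rw [le_div_iff₀ hh] at hfl
      rw [div_lt_iff₀ hh] at hfu
      -- The index is the floor, except that `x = b` has floor `m`; the closed last part takes both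
      -- floors `m - 1` and `m`.
      by_cases hlast : ⌊(x - a) / ((b - a) / m)⌋₊ + 1 < m
      · refine ⟨⟨_, (Nat.lt_succ_self _).trans hlast⟩, ?_⟩
        rw [rangeEquipartition, if_neg hlast.ne]
        exact ⟨by simp only; linarith, by simp only; linarith⟩
      · refine ⟨⟨m - 1, by omega⟩, ?_⟩
        rw [rangeEquipartition, if_pos (by simp only; omega)]
        refine ⟨?_, hx.2⟩
        have h4 : ((m - 1 : ℕ) : ℝ) ≤ ⌊(x - a) / ((b - a) / m)⌋₊ := by
          exact_mod_cast (by omega : m - 1 ≤ ⌊(x - a) / ((b - a) / m)⌋₊)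
        simp only
        nlinarith

/-- For `a = b` all parts but the last are empty, so this is no partition into nonempty intervals.
The equipartition of `[a - 1, a]` has the same trace on `{a}` and can be extended instead. -/
theorem exists_extension_rangeEquipartition {a b : ℝ} (hab : a ≤ b) {m : ℕ} (hm : 0 < m) :
    ∃ P' : Fin m → Set ℝ, IsIntervalPartition Set.univ P' ∧
      ∀ i, ∀ x ∈ Set.Icc a b, x ∈ P' i ↔ x ∈ rangeEquipartition a b m i := by
  rcases hab.eq_or_lt with rfl | hlt
  · obtain ⟨P', h1, h2⟩ := (isIntervalPartition_rangeEquipartition (sub_one_lt a)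
      hm).exists_extension (sub_one_lt a).le
    refine ⟨P', h1, fun i x hx => ?_⟩
    obtain rfl : x = a := le_antisymm hx.2 hx.1
    rw [h2 i x ⟨(sub_one_lt x).le, le_rfl⟩]
    have hm' : (0 : ℝ) < m := by exact_mod_cast hm
    rw [rangeEquipartition, rangeEquipartition]
    split_ifs with h
    · have h3 : ((i : ℕ) : ℝ) + 1 = m := by exact_mod_cast h
      have h4 : ((i : ℕ) : ℝ) / m ≤ 1 := by rw [div_le_one hm']; linarith
      simp only [Set.mem_Icc, sub_self, zero_div, mul_zero, add_zero, le_refl, and_true,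
        sub_sub_cancel, mul_one_div, iff_true]
      linarith
    · have h3 : ((i : ℕ) : ℝ) + 1 ≤ m := by exact_mod_cast i.2
      have h4 : (((i : ℕ) : ℝ) + 1) / m ≤ 1 := by rwa [div_le_one hm']
      simp only [Set.mem_Ico, sub_self, zero_div, mul_zero, add_zero, le_refl, true_and,
        sub_sub_cancel, mul_one_div, lt_irrefl, iff_false, not_and, not_lt]
      intro _
      linarith
  · exact (isIntervalPartition_rangeEquipartition hlt hm).exists_extension hab

end Partition

/-! ### Grids and unions of their cells -/

/-- The union of the cells of `G` with indices in `S`. -/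
def gridUnion {k l : ℕ} (G : Grid k l) (S : Finset (Fin k × Fin l)) : Set (ℝ × ℝ) :=
  ⋃ ij ∈ S, G.Q ij.2 ×ˢ G.P ij.1

/-- The grid of two range equipartitions of `L`, with `r` rows and `s` columns. -/
def equipartitionGrid (L : Range) (r s : ℕ) : Grid r s :=
  ⟨rangeEquipartition L.y₀ L.y₁ r, rangeEquipartition L.x₀ L.x₁ s⟩

/-- The rows and the columns of `G` are pairwise disjoint intervals. -/
structure Grid.IsDisjoint {k l : ℕ} (G : Grid k l) : Prop where
  ordP : ∀ i, (G.P i).OrdConnected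
  ordQ : ∀ j, (G.Q j).OrdConnected
  eqP : ∀ {i j x}, x ∈ G.P i → x ∈ G.P j → i = j
  eqQ : ∀ {i j x}, x ∈ G.Q i → x ∈ G.Q j → i = j

section Grid

variable {k l : ℕ}

theorem Grid.IsDisjoint.measurableSet_cell {G : Grid k l} (hG : G.IsDisjoint) (i : Fin k)
    (j : Fin l) : MeasurableSet (G.Q j ×ˢ G.P i) :=
  (hG.ordQ j).measurableSet.prod (hG.ordP i).measurableSet

theorem Grid.IsDisjoint.measurableSet_gridUnion {G : Grid k l} (hG : G.IsDisjoint)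
    (S : Finset (Fin k × Fin l)) : MeasurableSet (gridUnion G S) :=
  Finset.measurableSet_biUnion _ fun ij _ => hG.measurableSet_cell ij.1 ij.2

theorem Grid.IsDisjoint.measureReal_gridUnion {G : Grid k l} (hG : G.IsDisjoint)
    (μ : Measure (ℝ × ℝ)) [IsFiniteMeasure μ] (S : Finset (Fin k × Fin l)) :
    μ.real (gridUnion G S) = ∑ ij ∈ S, probMatrix μ G ij.1 ij.2 := by
  refine measureReal_biUnion_finset ?_ fun ij _ => hG.measurableSet_cell ij.1 ij.2
  intro u _ v _ huv
  refine Set.disjoint_left.2 fun x hx hy => huv (Prod.ext (hG.eqP hx.2 hy.2) (hG.eqQ hx.1 hy.1))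

theorem probMatrix_nonneg (μ : Measure (ℝ × ℝ)) (G : Grid k l) (i : Fin k) (j : Fin l) :
    0 ≤ probMatrix μ G i j := measureReal_nonneg

theorem Grid.IsDisjoint.sum_probMatrix_le {G : Grid k l} (hG : G.IsDisjoint)
    (μ : Measure (ℝ × ℝ)) [IsFiniteMeasure μ] :
    ∑ i, ∑ j, probMatrix μ G i j ≤ μ.real Set.univ := by
  rw [← Fintype.sum_prod_type' (f := fun i j => probMatrix μ G i j),
    ← hG.measureReal_gridUnion μ Finset.univ]
  exact measureReal_mono (Set.subset_univ _)

/-- Two measures which are close on all unions of cells are close in total variation. -/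
theorem Grid.IsDisjoint.sum_abs_probMatrix_sub_le {G : Grid k l} (hG : G.IsDisjoint)
    (μ ν : Measure (ℝ × ℝ)) [IsFiniteMeasure μ] [IsFiniteMeasure ν] {t : ℝ}
    (h : ∀ S, |μ.real (gridUnion G S) - ν.real (gridUnion G S)| ≤ t) :
    ∑ i, ∑ j, |probMatrix μ G i j - probMatrix ν G i j| ≤ 2 * t := by
  classical
  rw [← Fintype.sum_prod_type' (f := fun i j => |probMatrix μ G i j - probMatrix ν G i j|)]
  set d : Fin k × Fin l → ℝ := fun ij => probMatrix μ G ij.1 ij.2 - probMatrix ν G ij.1 ij.2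
  have h' : ∀ S : Finset (Fin k × Fin l), |∑ ij ∈ S, d ij| ≤ t := fun S => by
    have := h S
    rwa [hG.measureReal_gridUnion, hG.measureReal_gridUnion, ← Finset.sum_sub_distrib] at this
  -- The cells where the difference is nonnegative, and those where it is negative, form two unions
  -- of cells; each contributes `t`.
  have h1 := h' (Finset.univ.filter fun ij => 0 ≤ d ij)
  have h2 := h' (Finset.univ.filter fun ij => ¬ 0 ≤ d ij)
  change ∑ ij, |d ij| ≤ _
  rw [← Finset.sum_filter_add_sum_filter_not Finset.univ (fun ij => 0 ≤ d ij)]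
  have e1 : ∑ ij with 0 ≤ d ij, |d ij| = ∑ ij with 0 ≤ d ij, d ij :=
    Finset.sum_congr rfl fun ij hij => abs_of_nonneg (Finset.mem_filter.1 hij).2
  have e2 : ∑ ij with ¬ 0 ≤ d ij, |d ij| = -∑ ij with ¬ 0 ≤ d ij, d ij := by
    rw [← Finset.sum_neg_distrib]
    exact Finset.sum_congr rfl fun ij hij =>
      abs_of_neg (not_le.1 (Finset.mem_filter.1 hij).2)
  rw [e1, e2]
  linarith [(abs_le.1 h1).2, (abs_le.1 h2).1]

theorem isDisjoint_of_mem_allGrids {G : Grid k l} (hG : G ∈ allGrids k l) : G.IsDisjoint :=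
  ⟨hG.1.ordConnected, hG.2.ordConnected, hG.1.eq_of_mem, hG.2.eq_of_mem⟩

theorem isDisjoint_equipartitionGrid {L : Range} (hx : L.x₀ ≤ L.x₁) (hy : L.y₀ ≤ L.y₁) :
    (equipartitionGrid L k l).IsDisjoint :=
  ⟨ordConnected_rangeEquipartition _ _ _, ordConnected_rangeEquipartition _ _ _,
    rangeEquipartition_eq_of_mem hy, rangeEquipartition_eq_of_mem hx⟩

theorem isDisjoint_of_mem_rangeGrids {L : Range} (hx : L.x₀ ≤ L.x₁) (hy : L.y₀ ≤ L.y₁) {c : ℝ}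
    {G : Grid k l} (hG : G ∈ rangeGrids L c k l) : G.IsDisjoint := by
  rw [rangeGrids] at hG
  split_ifs at hG
  · obtain ⟨h1, h2, -⟩ := hG
    exact ⟨h2.ordConnected, h1 ▸ ordConnected_rangeEquipartition _ _ _, h2.eq_of_mem,
      h1 ▸ rangeEquipartition_eq_of_mem hx⟩
  · obtain ⟨h1, h2, -⟩ := hG
    exact ⟨h1 ▸ ordConnected_rangeEquipartition _ _ _, h2.ordConnected,
      h1 ▸ rangeEquipartition_eq_of_mem hy, h2.eq_of_mem⟩

theorem IsSubpartition.refl {j : ℕ} (C : Fin j → Set ℝ) : IsSubpartition C C :=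
  fun i => ⟨i, i, by simp⟩

/-- This lets the union bound run over subsets of one fine grid instead of over all its coarsenings.
-/
theorem exists_gridUnion_eq_of_isSubpartition {r s : ℕ} {G : Grid k l} {C : Grid r s}
    (hP : IsSubpartition G.P C.P) (hQ : IsSubpartition G.Q C.Q) (S : Finset (Fin k × Fin l)) :
    ∃ A, gridUnion G S = gridUnion C A := by
  classical
  choose a b hab using hP
  choose a' b' hab' using hQ
  refine ⟨S.biUnion fun ij => Finset.Icc (a ij.1) (b ij.1) ×ˢ Finset.Icc (a' ij.2) (b' ij.2), ?_⟩
  ext x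
  simp only [gridUnion, hab, hab', Set.mem_iUnion, Set.mem_prod, Finset.mem_biUnion,
    Finset.mem_product, Finset.mem_Icc, Set.mem_Icc, exists_prop, Prod.exists]
  constructor
  · rintro ⟨i, j, hij, ⟨v, hv, hxv⟩, ⟨u, hu, hxu⟩⟩
    exact ⟨u, v, ⟨i, j, hij, hu, hv⟩, hxv, hxu⟩
  · rintro ⟨u, v, ⟨i, j, hij, hu, hv⟩, hxv, hxu⟩
    exact ⟨i, j, hij, ⟨v, hv, hxv⟩, ⟨u, hu, hxu⟩⟩

theorem exists_gridUnion_eq_of_mem_rangeGrids {L : Range} {c : ℝ} {G : Grid k l}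
    (hG : G ∈ rangeGrids L c k l) (S : Finset (Fin k × Fin l)) :
    if k ≤ l then ∃ A, gridUnion G S = gridUnion (equipartitionGrid L ⌊c * l⌋₊ l) A
    else ∃ A, gridUnion G S = gridUnion (equipartitionGrid L k ⌊c * k⌋₊) A := by
  rw [rangeGrids] at hG
  split_ifs at hG ⊢
  · exact exists_gridUnion_eq_of_isSubpartition hG.2.2 (hG.1 ▸ IsSubpartition.refl _) S
  · exact exists_gridUnion_eq_of_isSubpartition (hG.1 ▸ IsSubpartition.refl _) hG.2.2 S

end Grid

/-! ### Population scores and the upper bound by `MIC*` -/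

section Population

variable {k l : ℕ} {Pi : Measure (ℝ × ℝ)} [IsProbabilityMeasure Pi]

theorem sum_probMatrix_of_mem_allGrids (Pi : Measure (ℝ × ℝ)) [IsProbabilityMeasure Pi]
    {G : Grid k l} (hG : G ∈ allGrids k l) : ∑ i, ∑ j, probMatrix Pi G i j = 1 := by
  rw [← Fintype.sum_prod_type' (f := fun i j => probMatrix Pi G i j),
    ← (isDisjoint_of_mem_allGrids hG).measureReal_gridUnion Pi Finset.univ]
  have : gridUnion G Finset.univ = Set.univ := by
    refine Set.eq_univ_of_forall fun x => ?_
    obtain ⟨i, hi⟩ := Set.mem_iUnion.1 (hG.1.iUnion_eq.symm ▸ Set.mem_univ x.2)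
    obtain ⟨j, hj⟩ := Set.mem_iUnion.1 (hG.2.iUnion_eq.symm ▸ Set.mem_univ x.1)
    exact Set.mem_iUnion₂.2 ⟨(i, j), Finset.mem_univ _, hj, hi⟩
  rw [this, probReal_univ]

theorem normalizedMI_probMatrix_nonneg (hk : 2 ≤ k) (hl : 2 ≤ l) {G : Grid k l}
    (hG : G.IsDisjoint) (μ : Measure (ℝ × ℝ)) [IsFiniteMeasure μ] (hμ : μ.real Set.univ ≤ 1) :
    0 ≤ normalizedMI (probMatrix μ G) :=
  normalizedMI_nonneg hk hl _ (probMatrix_nonneg μ G) ((hG.sum_probMatrix_le μ).trans hμ)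

theorem normalizedMI_le_one_of_mem_allGrids (hk : 2 ≤ k) (hl : 2 ≤ l) {G : Grid k l}
    (hG : G ∈ allGrids k l) : normalizedMI (probMatrix Pi G) ≤ 1 :=
  normalizedMI_le_one hk hl _ (probMatrix_nonneg Pi G) (sum_probMatrix_of_mem_allGrids Pi hG)

theorem charEntry_nonneg (hk : 2 ≤ k) (hl : 2 ≤ l) : 0 ≤ charEntry Pi k l :=
  Real.sSup_nonneg fun _ ⟨_, hG, h⟩ => h ▸ normalizedMI_probMatrix_nonneg hk hl
    (isDisjoint_of_mem_allGrids hG) Pi probReal_univ.le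

theorem charEntry_le_one (hk : 2 ≤ k) (hl : 2 ≤ l) : charEntry Pi k l ≤ 1 :=
  Real.sSup_le (fun _ ⟨_, hG, h⟩ => h ▸ normalizedMI_le_one_of_mem_allGrids hk hl hG) zero_le_one

theorem micStar_nonneg : 0 ≤ micStar Pi :=
  Real.sSup_nonneg fun _ ⟨_, _, hk, hl, h⟩ => h ▸ charEntry_nonneg hk hl

theorem micStar_le_one : micStar Pi ≤ 1 :=
  Real.sSup_le (fun _ ⟨_, _, hk, hl, h⟩ => h ▸ charEntry_le_one hk hl) zero_le_one

theorem normalizedMI_le_micStar_of_mem_allGrids (hk : 2 ≤ k) (hl : 2 ≤ l) {G : Grid k l}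
    (hG : G ∈ allGrids k l) : normalizedMI (probMatrix Pi G) ≤ micStar Pi := by
  have h1 : BddAbove ((fun G => normalizedMI (probMatrix Pi G)) '' allGrids k l) :=
    ⟨1, fun _ ⟨_, hG, h⟩ => h ▸ normalizedMI_le_one_of_mem_allGrids hk hl hG⟩
  have h2 : BddAbove {v | ∃ k l : ℕ, 2 ≤ k ∧ 2 ≤ l ∧ v = charEntry Pi k l} :=
    ⟨1, fun _ ⟨_, _, hk, hl, h⟩ => h ▸ charEntry_le_one hk hl⟩
  exact (le_csSup h1 (Set.mem_image_of_mem _ hG)).trans (le_csSup h2 ⟨k, l, hk, hl, rfl⟩)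

/-- Range grids cover only `L`, while `MIC*` ranges over grids of the plane; this bridges the two
for a distribution carried by `L`. -/
theorem exists_mem_allGrids_of_mem_rangeGrids {L : Range} (hx : L.x₀ ≤ L.x₁) (hy : L.y₀ ≤ L.y₁)
    {c : ℝ} (hk : 0 < k) (hl : 0 < l) {G : Grid k l} (hG : G ∈ rangeGrids L c k l) :
    ∃ G' ∈ allGrids k l, ∀ i j, ∀ d ∈ L.toSet, d ∈ G'.Q j ×ˢ G'.P i ↔ d ∈ G.Q j ×ˢ G.P i := by
  rw [rangeGrids] at hG
  split_ifs at hG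
  · obtain ⟨h1, h2, -⟩ := hG
    obtain ⟨P', hP', hPP⟩ := h2.exists_extension hy
    obtain ⟨Q', hQ', hQQ⟩ := exists_extension_rangeEquipartition hx hl
    exact ⟨⟨P', Q'⟩, ⟨hP', hQ'⟩, fun i j d hd => by
      simp only [Set.mem_prod, hPP i _ hd.2, hQQ j _ hd.1, h1]⟩
  · obtain ⟨h1, h2, -⟩ := hG
    obtain ⟨Q', hQ', hQQ⟩ := h2.exists_extension hx
    obtain ⟨P', hP', hPP⟩ := exists_extension_rangeEquipartition hy hk
    exact ⟨⟨P', Q'⟩, ⟨hP', hQ'⟩, fun i j d hd => by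
      simp only [Set.mem_prod, hPP i _ hd.2, hQQ j _ hd.1, h1]⟩

theorem normalizedMI_le_micStar_of_mem_rangeGrids {L : Range} (hx : L.x₀ ≤ L.x₁)
    (hy : L.y₀ ≤ L.y₁) (hPi : ∀ᵐ d ∂Pi, d ∈ L.toSet) {c : ℝ} (hk : 2 ≤ k) (hl : 2 ≤ l)
    {G : Grid k l} (hG : G ∈ rangeGrids L c k l) :
    normalizedMI (probMatrix Pi G) ≤ micStar Pi := by
  obtain ⟨G', hG', h⟩ := exists_mem_allGrids_of_mem_rangeGrids hx hy (by omega) (by omega) hG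
  have : probMatrix Pi G = probMatrix Pi G' := by
    funext i j
    exact measureReal_congr (hPi.mono fun d hd => propext (h i j d hd).symm)
  rw [this]
  exact normalizedMI_le_micStar_of_mem_allGrids hk hl hG'

theorem range_nonempty {L : Range} (hPi : ∀ᵐ d ∂Pi, d ∈ L.toSet) :
    L.x₀ ≤ L.x₁ ∧ L.y₀ ≤ L.y₁ := by
  obtain ⟨d, hd⟩ := hPi.exists
  exact ⟨hd.1.1.trans hd.1.2, hd.2.1.trans hd.2.2⟩

end Population

/-! ### Approximating partitions by coarsened equipartitions -/

/-- A monotone map to `Fin k` from a chain with at least `k` elements factors through a monotone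
surjection onto `Fin k`. -/
theorem exists_monotone_surjective_factor {j k : ℕ} (hk : 0 < k) (hkj : k ≤ j)
    (u : Fin j → Fin k) (hu : Monotone u) :
    ∃ (h : Fin j → Fin k) (φ : Fin k → Fin k), Monotone h ∧ Function.Surjective h ∧
      ∀ t, φ (h t) = u t := by
  classical
  -- `c n` counts the distinct values of `u` up to index `n`; it grows by at most one per step and
  -- is constant exactly where `u` is.
  set c : ℕ → ℕ := fun n => (Finset.image u (Finset.univ.filter fun t => (t : ℕ) ≤ n)).card with hc
  have hsub : ∀ {m n}, m ≤ n → Finset.image u (Finset.univ.filter fun t => (t : ℕ) ≤ m) ⊆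
      Finset.image u (Finset.univ.filter fun t => (t : ℕ) ≤ n) := fun hmn =>
    Finset.image_subset_image (Finset.monotone_filter_right _ fun t _ ht => le_trans ht hmn)
  have hcm : ∀ {m n}, m ≤ n → c m ≤ c n := fun hmn => Finset.card_le_card (hsub hmn)
  have hc1 : ∀ n, 1 ≤ c n := fun n => Finset.card_pos.2
    ⟨u ⟨0, by omega⟩, Finset.mem_image_of_mem _ (by simp)⟩
  have hck : ∀ n, c n ≤ k := fun n => (Finset.card_le_univ _).trans_eq (Fintype.card_fin k)
  have hc0 : c 0 ≤ 1 := by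
    refine Finset.card_image_le.trans (Finset.card_le_one.2 fun s hs t ht => Fin.ext ?_)
    have := (Finset.mem_filter.1 hs).2
    have := (Finset.mem_filter.1 ht).2
    omega
  have hcs : ∀ n, n + 1 < j → c (n + 1) ≤ c n + 1 := by
    intro n hn
    have : Finset.image u (Finset.univ.filter fun t => (t : ℕ) ≤ n + 1) ⊆
        insert (u ⟨n + 1, hn⟩) (Finset.image u (Finset.univ.filter fun t => (t : ℕ) ≤ n)) := by
      rw [← Finset.image_insert]
      refine Finset.image_subset_image fun t ht => ?_
      simp only [Finset.mem_filter, Finset.mem_univ, true_and, Finset.mem_insert, Fin.ext_iff] at *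
      omega
    exact (Finset.card_le_card this).trans (Finset.card_insert_le _ _)
  have huc : ∀ s t : Fin j, s ≤ t → c s = c t → u s = u t := by
    intro s t hst h
    have heq := Finset.eq_of_subset_of_card_le (hsub (m := s) (n := t) hst) h.ge
    have hmem : u t ∈ Finset.image u (Finset.univ.filter fun r : Fin j => (r : ℕ) ≤ s) := by
      rw [heq]
      exact Finset.mem_image_of_mem _ (by simp)
    obtain ⟨r, hr, hrt⟩ := Finset.mem_image.1 hmem
    exact le_antisymm (hu hst) (hrt ▸ hu (Finset.mem_filter.1 hr).2)
  -- The first term separates the values of `u`; the second, a truncated subtraction reaching `k -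
  -- 1` at `n = j - 1`, forces the last label to be attained.
  set H : ℕ → ℕ := fun n => max (c n - 1) (n + k - j) with hH
  have hHk : ∀ t : Fin j, H t < k := fun t => by
    have := hck t
    have := t.2
    simp only [hH]
    omega
  have hHm : ∀ {m n}, m ≤ n → H m ≤ H n := fun {m n} hmn => by
    have := hcm hmn
    simp only [hH]
    omega
  -- Once positive, `n + k - j` strictly increases, so two equal values of `H` must come from equal
  -- values of `c`.
  have hker : ∀ s t : Fin j, s < t → H s = H t → u s = u t := by
    intro s t hst h
    refine huc s t hst.le ?_
    have h1 := hcm (show (s : ℕ) ≤ t from hst.le)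
    have h2 := hc1 s
    have h3 : (s : ℕ) < t := hst
    simp only [hH] at h
    omega
  have hsurj : Function.Surjective fun t : Fin j => (⟨H t, hHk t⟩ : Fin k) := by
    intro v
    have hex : ∃ n, (v : ℕ) ≤ H n := ⟨j - 1, by
      have := v.2
      simp only [hH]
      omega⟩
    have hlt : Nat.find hex < j := by
      have : Nat.find hex ≤ j - 1 := Nat.find_min' hex (by
        have := v.2
        simp only [hH]
        omega)
      omega
    -- `H` starts at `0` and rises by at most one per step, so the first index reaching `v` does not
    -- overshoot.
    refine ⟨⟨Nat.find hex, hlt⟩, Fin.ext (le_antisymm ?_ (Nat.find_spec hex))⟩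
    rcases Nat.eq_zero_or_pos (Nat.find hex) with h0 | hpos
    · simp only [h0, hH]
      omega
    · have h1 := Nat.find_min hex (Nat.sub_one_lt hpos.ne')
      have h2 := hcs (Nat.find hex - 1) (by omega)
      have h3 := hc1 (Nat.find hex - 1)
      rw [Nat.sub_add_cancel hpos] at h2
      simp only [hH] at h1 ⊢
      omega
  refine ⟨fun t => ⟨H t, hHk t⟩, fun v => u (Function.surjInv hsurj v), fun s t hst => hHm hst,
    hsurj, fun t => ?_⟩
  have h := congrArg Fin.val (Function.surjInv_eq hsurj ⟨H t, hHk t⟩)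
  rcases lt_trichotomy (Function.surjInv hsurj ⟨H t, hHk t⟩) t with h1 | h1 | h1
  · exact hker _ _ h1 h
  · exact congrArg u h1
  · exact (hker _ _ h1 h.symm).symm

/-- Merging the parts of an interval partition along a monotone surjection. -/
theorem IsIntervalPartition.merge {I : Set ℝ} [hI : I.OrdConnected] {j k : ℕ} {C : Fin j → Set ℝ}
    (hC : IsIntervalPartition I C) {h : Fin j → Fin k} (hm : Monotone h)
    (hs : Function.Surjective h) :
    IsIntervalPartition I fun i => ⋃ t ∈ {t | h t = i}, C t := by
  refine ⟨fun i => ?_, fun i => ⟨?_⟩, ?_, ?_⟩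
  · obtain ⟨t, ht⟩ := hs i
    exact (hC.nonempty t).mono (Set.subset_biUnion_of_mem (u := C) ht)
  · intro x hx z hz y hy
    simp only [Set.mem_iUnion, Set.mem_ofPred_eq, exists_prop] at hx hz ⊢
    obtain ⟨r, hr, hxr⟩ := hx
    obtain ⟨s, hs, hzs⟩ := hz
    have hyI : y ∈ I := hI.out (hC.iUnion_eq ▸ Set.mem_iUnion_of_mem r hxr)
      (hC.iUnion_eq ▸ Set.mem_iUnion_of_mem s hzs) hy
    rw [← hC.iUnion_eq] at hyI
    obtain ⟨t, ht⟩ := Set.mem_iUnion.1 hyI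
    have h1 : r ≤ t := not_lt.1 fun hlt => (hC.ordered t r hlt y ht x hxr).not_ge hy.1
    have h2 : t ≤ s := not_lt.1 fun hlt => (hC.ordered s t hlt z hzs y ht).not_ge hy.2
    exact ⟨t, le_antisymm (hs ▸ hm h2) (hr ▸ hm h1), ht⟩
  · intro i i' hii x hx y hy
    simp only [Set.mem_iUnion, Set.mem_ofPred_eq, exists_prop] at hx hy
    obtain ⟨r, hr, hxr⟩ := hx
    obtain ⟨s, hs, hys⟩ := hy
    refine hC.ordered r s (lt_of_not_ge fun hle => ?_) x hxr y hys
    have := hm hle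
    rw [hr, hs] at this
    exact this.not_gt hii
  · rw [← hC.iUnion_eq]
    ext x
    simp

/-- A nonempty fibre of a monotone map is the interval from its minimum to its maximum. -/
theorem isSubpartition_merge {j k : ℕ} (C : Fin j → Set ℝ) {h : Fin j → Fin k} (hm : Monotone h)
    (hs : Function.Surjective h) : IsSubpartition (fun i => ⋃ t ∈ {t | h t = i}, C t) C := by
  classical
  intro i
  have hne : (Finset.univ.filter fun t => h t = i).Nonempty := by
    obtain ⟨t, ht⟩ := hs i
    exact ⟨t, by simpa using ht⟩
  refine ⟨_, _, congrArg (fun S => ⋃ t ∈ S, C t) (?_ : {t | h t = i} =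
    Set.Icc (Finset.min' _ hne) (Finset.max' _ hne))⟩
  have h1 := (Finset.mem_filter.1 (Finset.min'_mem _ hne)).2
  have h2 := (Finset.mem_filter.1 (Finset.max'_mem _ hne)).2
  ext t
  constructor
  · intro ht
    have : t ∈ Finset.univ.filter fun t => h t = i := by simpa using ht
    exact ⟨Finset.min'_le _ _ this, Finset.le_max' _ _ this⟩
  · rintro ⟨ha, hb⟩
    exact le_antisymm (h2 ▸ hm hb) (h1 ▸ hm ha)

/-- Up to finitely many points, each point of a partition of the line has a neighbourhood inside
its part. -/
theorem IsIntervalPartition.exists_finite_cuts {k : ℕ} {P : Fin k → Set ℝ}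
    (hP : IsIntervalPartition Set.univ P) :
    ∃ T : Set ℝ, T.Finite ∧ ∀ i, ∀ y ∈ P i, y ∉ T → ∀ᶠ z in 𝓝 y, z ∈ P i := by
  -- For an unbounded part the default value `0` of `sInf` or `sSup` only adds a harmless extra
  -- point.
  refine ⟨⋃ i, {sInf (P i), sSup (P i)}, Set.finite_iUnion fun i => by simp, fun i y hy hyT => ?_⟩
  simp only [Set.mem_iUnion, Set.mem_insert_iff, Set.mem_singleton_iff, not_exists, not_or] at hyT
  obtain ⟨hinf, hsup⟩ := hyT i
  obtain ⟨a, ha, hay⟩ : ∃ a ∈ P i, a < y := by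
    by_contra! h
    exact hinf (IsLeast.csInf_eq ⟨hy, h⟩).symm
  obtain ⟨b, hb, hyb⟩ : ∃ b ∈ P i, y < b := by
    by_contra! h
    exact hsup (IsGreatest.csSup_eq ⟨hy, h⟩).symm
  filter_upwards [Icc_mem_nhds hay hyb] with z hz
  exact (hP.ordConnected i).out ha hb hz

/-- A partition of the line is the pointwise limit on `[a, b]` of coarsenings of the range
equipartitions of `[a, b]`. -/
theorem IsIntervalPartition.exists_approximation {k : ℕ} {P : Fin k → Set ℝ}
    (hP : IsIntervalPartition Set.univ P) {a b : ℝ} (hab : a < b) :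
    ∃ u : ∀ m : ℕ, Fin m → Fin k, (∀ m, Monotone (u m)) ∧
      ∀ y ∈ Set.Icc a b, ∀ i, ∀ᶠ m in atTop,
        (y ∈ ⋃ t ∈ {t | u m t = i}, rangeEquipartition a b m t) ↔ y ∈ P i := by
  obtain ⟨T, hTfin, hT⟩ := hP.exists_finite_cuts
  have hlabel : ∀ y, ∃ i, y ∈ P i := fun y =>
    Set.mem_iUnion.1 (hP.iUnion_eq.symm ▸ Set.mem_univ y)
  choose f hf using hlabel
  -- Each cell takes the label of a representative, chosen to be a cut point if the cell contains
  -- one. For fine meshes a cut point represents its own cell, so convergence holds at every point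
  -- and atoms on the cuts do no harm.
  have hrep : ∀ m (t : Fin m), ∃ x ∈ rangeEquipartition a b m t,
      (∃ s ∈ T, s ∈ rangeEquipartition a b m t) → x ∈ T := by
    intro m t
    by_cases h : ∃ s ∈ T, s ∈ rangeEquipartition a b m t
    · obtain ⟨s, hs, hst⟩ := h
      exact ⟨s, hst, fun _ => hs⟩
    · obtain ⟨x, hx⟩ := (isIntervalPartition_rangeEquipartition hab t.pos).nonempty t
      exact ⟨x, hx, fun h' => absurd h' h⟩
  choose x hx hxT using hrep
  refine ⟨fun m t => f (x m t), fun m s t hst => ?_, fun y hy i => ?_⟩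
  · rcases hst.eq_or_lt with rfl | hlt
    · exact le_rfl
    · have h1 := rangeEquipartition_ordered hab.le hlt (hx m s) (hx m t)
      exact not_lt.1 fun h2 => (hP.ordered _ _ h2 _ (hf _) _ (hf _)).not_gt h1
  · have hnear : ∀ᶠ z in 𝓝 y, (z ∈ T → z = y) ∧ (y ∉ T → z ∈ P (f y)) := by
      refine Filter.Eventually.and ?_ ?_
      · have : (T \ {y})ᶜ ∈ 𝓝 y :=
          (hTfin.subset Set.sdiff_subset).isClosed.isOpen_compl.mem_nhds (by simp)
        filter_upwards [this] with z hz hzT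
        by_contra hne
        exact hz ⟨hzT, hne⟩
      · by_cases hyT : y ∈ T
        · exact Eventually.of_forall fun z h => absurd hyT h
        · exact (hT _ y (hf y) hyT).mono fun z hz _ => hz
    obtain ⟨δ, hδ, hball⟩ := Metric.eventually_nhds_iff.1 hnear
    have hlim : Tendsto (fun m : ℕ => (b - a) / m) atTop (𝓝 0) :=
      tendsto_const_div_atTop_nhds_zero_nat _
    filter_upwards [hlim.eventually_lt_const hδ, eventually_gt_atTop 0] with m hm hm0
    have hpart := isIntervalPartition_rangeEquipartition hab hm0
    have hcell : ∀ t, y ∈ rangeEquipartition a b m t → f (x m t) = f y := by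
      intro t ht
      have h1 := mem_rangeEquipartition_lower ht
      have h2 := mem_rangeEquipartition_upper ht
      have h3 := mem_rangeEquipartition_lower (hx m t)
      have h4 := mem_rangeEquipartition_upper (hx m t)
      have hd : dist (x m t) y < δ := by
        rw [Real.dist_eq]
        refine lt_of_le_of_lt ?_ hm
        rw [abs_le]
        constructor <;> linarith
      obtain ⟨h5, h6⟩ := hball hd
      by_cases hyT : y ∈ T
      · rw [h5 (hxT m t ⟨y, hyT, ht⟩)]
      · exact hP.eq_of_mem (hf _) (h6 hyT)
    obtain ⟨t, ht⟩ := Set.mem_iUnion.1 (hpart.iUnion_eq.symm ▸ hy)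
    simp only [Set.mem_iUnion, exists_prop]
    constructor
    · rintro ⟨s, hs, hys⟩
      rw [← hs, hcell s hys]
      exact hf y
    · intro hyi
      exact ⟨t, (hcell t ht).trans (hP.eq_of_mem (hf y) hyi), ht⟩

/-! ### Range grids attain `MIC*` in the limit -/

section Approximation

variable {k l : ℕ} {Pi : Measure (ℝ × ℝ)} [IsProbabilityMeasure Pi] {L : Range}

/-- The approximating matrix is a merging of the matrix of a range grid with `k` rows and `m`
columns. Strictness of `k < m` keeps the transposed grid in the other branch of `rangeGrids`. -/
theorem exists_mem_rangeGrids_gt_of_le (hx : L.x₀ < L.x₁) (hy : L.y₀ < L.y₁)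
    (hPi : ∀ᵐ d ∂Pi, d ∈ L.toSet) {c : ℝ} (hc : 0 < c) (hk : 2 ≤ k) (hkl : k ≤ l) {G : Grid k l}
    (hG : G ∈ allGrids k l) {v : ℝ} (hv : v < normalizedMI (probMatrix Pi G)) :
    ∃ m, k < m ∧ ∃ G' ∈ rangeGrids L c k m, v < normalizedMI (probMatrix Pi G') := by
  obtain ⟨u, hu, hulim⟩ := hG.1.exists_approximation hy
  obtain ⟨w, hw, hwlim⟩ := hG.2.exists_approximation hx
  have hcm : Tendsto (fun m : ℕ => ⌊c * m⌋₊) atTop atTop :=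
    tendsto_nat_floor_atTop.comp (tendsto_natCast_atTop_atTop.const_mul_atTop hc)
  set R : ∀ m : ℕ, Fin k → Set ℝ := fun m i =>
    ⋃ t ∈ {t | u m t = i}, rangeEquipartition L.y₀ L.y₁ m t with hR
  set S : ∀ m : ℕ, Fin l → Set ℝ := fun m i =>
    ⋃ t ∈ {t | w m t = i}, rangeEquipartition L.x₀ L.x₁ m t with hS
  have hRm : ∀ m i, MeasurableSet (R m i) := fun m i => Set.Finite.measurableSet_biUnion
    (Set.toFinite _) fun t _ => (ordConnected_rangeEquipartition _ _ _ t).measurableSet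
  have hSm : ∀ m i, MeasurableSet (S m i) := fun m i => Set.Finite.measurableSet_biUnion
    (Set.toFinite _) fun t _ => (ordConnected_rangeEquipartition _ _ _ t).measurableSet
  set p : ℕ → Fin k → Fin l → ℝ := fun m i j => Pi.real (S m j ×ˢ R ⌊c * m⌋₊ i) with hp
  have hplim : Tendsto p atTop (𝓝 (probMatrix Pi G)) := by
    refine tendsto_pi_nhds.2 fun i => tendsto_pi_nhds.2 fun j => ?_
    refine (ENNReal.tendsto_toReal (measure_ne_top Pi _)).comp ?_
    refine tendsto_measure_of_ae_tendsto_indicator_of_isFiniteMeasure (L := atTop)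
      ((isDisjoint_of_mem_allGrids hG).measurableSet_cell i j)
      (fun m => (hSm m j).prod (hRm _ i)) ?_
    filter_upwards [hPi] with d hd
    filter_upwards [hwlim d.1 hd.1 j, hcm.eventually (hulim d.2 hd.2 i)] with m h1 h2
    exact and_congr h1 h2
  have hMI : Tendsto (fun m => normalizedMI (p m)) atTop (𝓝 (normalizedMI (probMatrix Pi G))) := by
    refine Tendsto.div_const ((continuousOn_mutualInfo _ (probMatrix_nonneg Pi G)).tendsto.comp
      (tendsto_nhdsWithin_iff.2 ⟨hplim, Eventually.of_forall fun m i j => measureReal_nonneg⟩)) _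
  obtain ⟨m, hm1, hm2, hm3⟩ := ((hMI.eventually (lt_mem_nhds hv)).and
    ((hcm.eventually_ge_atTop k).and (eventually_gt_atTop l))).exists
  -- The rounding `u` may miss labels, but a range grid needs exactly `k` nonempty rows; `h`
  -- supplies them and `φ` merges them back.
  obtain ⟨h, φ, hmono, hsurj, hφ⟩ :=
    exists_monotone_surjective_factor (by omega) hm2 (u ⌊c * m⌋₊) (hu _)
  have hpart := isIntervalPartition_rangeEquipartition hy (show 0 < ⌊c * (m : ℝ)⌋₊ by omega)
  set G' : Grid k m := ⟨fun i => ⋃ t ∈ {t | h t = i}, rangeEquipartition L.y₀ L.y₁ ⌊c * m⌋₊ t,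
    rangeEquipartition L.x₀ L.x₁ m⟩ with hG'
  have hG'mem : G' ∈ rangeGrids L c k m := by
    rw [rangeGrids, if_pos (by omega)]
    exact ⟨rfl, hpart.merge hmono hsurj, isSubpartition_merge _ hmono hsurj⟩
  refine ⟨m, by omega, G', hG'mem, hm1.trans_le ?_⟩
  have hmerge : p m = fun i j => ∑ i' with φ i' = i, ∑ j' with w m j' = j,
      probMatrix Pi G' i' j' := by
    funext i j
    rw [← Finset.sum_product' (f := fun i' j' => probMatrix Pi G' i' j'),
      ← (isDisjoint_of_mem_rangeGrids hx.le hy.le hG'mem).measureReal_gridUnion Pi]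
    change Pi.real (S m j ×ˢ R ⌊c * m⌋₊ i) = _
    congr 1
    ext d
    simp only [hS, hR, hG', gridUnion, Set.mem_prod, Set.mem_iUnion, Set.mem_ofPred_eq,
      exists_prop, Finset.mem_product, Finset.mem_filter, Finset.mem_univ, true_and, Prod.exists]
    constructor
    · rintro ⟨⟨s, hs, hds⟩, ⟨t, ht, hdt⟩⟩
      exact ⟨h t, s, ⟨(hφ t).trans ht, hs⟩, hds, t, rfl, hdt⟩
    · rintro ⟨i', s, ⟨hi', hs⟩, hds, t, ht, hdt⟩
      exact ⟨⟨s, hs, hds⟩, t, by rw [← hφ t, ht, hi'], hdt⟩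
  -- Both normalizers are `log k`, since `k` is the smaller side before and after refining the
  -- columns.
  rw [normalizedMI, normalizedMI, hmerge, min_eq_left hkl, min_eq_left (by omega : k ≤ m)]
  refine div_le_div_of_nonneg_right (mutualInfo_merge_le _ (probMatrix_nonneg Pi G') φ (w m)) ?_
  have := one_le_logb_min hk (hk.trans hkl)
  rw [min_eq_left hkl] at this
  linarith

theorem probMatrix_map_swap (Pi : Measure (ℝ × ℝ)) (G : Grid k l) :
    probMatrix (Pi.map Prod.swap) ⟨G.Q, G.P⟩ = fun j i => probMatrix Pi G i j := by
  funext j i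
  rw [probMatrix, probMatrix, measureReal_def, measureReal_def,
    show Pi.map Prod.swap = Pi.map MeasurableEquiv.prodComm from rfl, MeasurableEquiv.map_apply]
  congr 2
  ext d
  exact and_comm

theorem exists_mem_rangeGrids_gt (hx : L.x₀ < L.x₁) (hy : L.y₀ < L.y₁)
    (hPi : ∀ᵐ d ∂Pi, d ∈ L.toSet) {c : ℝ} (hc : 0 < c) (hk : 2 ≤ k) (hl : 2 ≤ l) {G : Grid k l}
    (hG : G ∈ allGrids k l) {v : ℝ} (hv : v < normalizedMI (probMatrix Pi G)) :
    ∃ k' l', 2 ≤ k' ∧ 2 ≤ l' ∧ ∃ G' ∈ rangeGrids L c k' l',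
      v < normalizedMI (probMatrix Pi G') := by
  rcases le_total k l with hkl | hkl
  · obtain ⟨m, hm, h⟩ := exists_mem_rangeGrids_gt_of_le hx hy hPi hc hk hkl hG hv
    exact ⟨k, m, hk, hk.trans hm.le, h⟩
  have hswap : Measurable (Prod.swap : ℝ × ℝ → ℝ × ℝ) := measurable_swap
  have : IsProbabilityMeasure (Pi.map Prod.swap) := Measure.isProbabilityMeasure_map
    hswap.aemeasurable
  have hPi' : ∀ᵐ d ∂Pi.map Prod.swap, d ∈ (Range.mk L.y₀ L.y₁ L.x₀ L.x₁).toSet := by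
    refine (ae_map_iff hswap.aemeasurable (measurableSet_Icc.prod measurableSet_Icc)).2 ?_
    filter_upwards [hPi] with d hd
    exact ⟨hd.2, hd.1⟩
  have hG' : (⟨G.Q, G.P⟩ : Grid l k) ∈ allGrids l k := ⟨hG.2, hG.1⟩
  obtain ⟨m, hm, F, hF, hvF⟩ := exists_mem_rangeGrids_gt_of_le (L := ⟨L.y₀, L.y₁, L.x₀, L.x₁⟩)
    hy hx hPi' hc hl hkl hG' (v := v) (by
      rwa [probMatrix_map_swap, normalizedMI_transpose])
  refine ⟨m, l, hl.trans hm.le, hl, ⟨F.Q, F.P⟩, ?_, ?_⟩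
  · rw [rangeGrids, if_pos hm.le] at hF
    rw [rangeGrids, if_neg (by omega)]
    exact hF
  · rwa [← normalizedMI_transpose, ← probMatrix_map_swap]

/-- If `Y` is almost surely constant, every grid has mutual information zero. -/
theorem normalizedMI_nonpos_of_snd_const {y : ℝ} (hy : ∀ᵐ d ∂Pi, d.2 = y) (hk : 2 ≤ k)
    (hl : 2 ≤ l) {G : Grid k l} (hG : G ∈ allGrids k l) :
    normalizedMI (probMatrix Pi G) ≤ 0 := by
  have h2 := Real.log_pos one_lt_two
  refine div_nonpos_of_nonpos_of_nonneg ?_ (zero_le_one.trans (one_le_logb_min hk hl))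
  refine le_of_mul_le_mul_right ?_ h2
  rw [zero_mul]
  refine (mutualInfo_mul_log_le_entropy _ (probMatrix_nonneg Pi G)).trans_eq ?_
  obtain ⟨i₀, hi₀⟩ := Set.mem_iUnion.1 (hG.1.iUnion_eq.symm ▸ Set.mem_univ y)
  have h0 : ∀ i, i ≠ i₀ → ∑ j, probMatrix Pi G i j = 0 := by
    intro i hi
    refine Finset.sum_eq_zero fun j _ => ?_
    rw [probMatrix, measureReal_def, measure_eq_zero_iff_ae_notMem.2, ENNReal.toReal_zero]
    filter_upwards [hy] with d hd hmem
    exact hi (hG.1.eq_of_mem (hd ▸ hmem.2) hi₀)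
  have h1 : ∑ j, probMatrix Pi G i₀ j = 1 := by
    rw [← sum_probMatrix_of_mem_allGrids Pi hG, Finset.sum_eq_single i₀ (fun i _ hi => h0 i hi)
      (by simp)]
  refine Finset.sum_eq_zero fun i _ => ?_
  by_cases hi : i = i₀
  · rw [hi, h1, Real.negMulLog_one]
  · rw [h0 i hi, Real.negMulLog_zero]

theorem normalizedMI_nonpos_of_fst_const {x : ℝ} (hx : ∀ᵐ d ∂Pi, d.1 = x) (hk : 2 ≤ k)
    (hl : 2 ≤ l) {G : Grid k l} (hG : G ∈ allGrids k l) :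
    normalizedMI (probMatrix Pi G) ≤ 0 := by
  have hswap : Measurable (Prod.swap : ℝ × ℝ → ℝ × ℝ) := measurable_swap
  have : IsProbabilityMeasure (Pi.map Prod.swap) := Measure.isProbabilityMeasure_map
    hswap.aemeasurable
  rw [← normalizedMI_transpose, ← probMatrix_map_swap]
  refine normalizedMI_nonpos_of_snd_const (y := x) ?_ hl hk ⟨hG.2, hG.1⟩
  exact (ae_map_iff hswap.aemeasurable (measurable_snd (measurableSet_singleton x))).2 hx

/-- The range grids of `L` suffice to approximate `MIC*`. -/
theorem exists_mem_rangeGrids_gt_of_lt_micStar (hPi : ∀ᵐ d ∂Pi, d ∈ L.toSet) {c : ℝ} (hc : 0 < c)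
    {v : ℝ} (hv0 : 0 ≤ v) (hv : v < micStar Pi) :
    ∃ k l, 2 ≤ k ∧ 2 ≤ l ∧ ∃ G ∈ rangeGrids L c k l, v < normalizedMI (probMatrix Pi G) := by
  obtain ⟨k, l, hk, hl, hkl⟩ : ∃ k l, 2 ≤ k ∧ 2 ≤ l ∧ v < charEntry Pi k l := by
    by_contra! h
    exact hv.not_ge (Real.sSup_le (fun _ ⟨k, l, hk, hl, e⟩ => e ▸ h k l hk hl) hv0)
  obtain ⟨G, hG, hvG⟩ : ∃ G ∈ allGrids k l, v < normalizedMI (probMatrix Pi G) := by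
    by_contra! h
    exact hkl.not_ge (Real.sSup_le (fun _ ⟨G, hG, e⟩ => e ▸ h G hG) hv0)
  obtain ⟨hx, hy⟩ := range_nonempty hPi
  -- If `L` is degenerate, one coordinate is almost surely constant and no score exceeds `v ≥ 0`.
  rcases hx.eq_or_lt with hx | hx
  · refine absurd (normalizedMI_nonpos_of_fst_const (x := L.x₀) ?_ hk hl hG)
      (hv0.trans_lt hvG).not_ge
    filter_upwards [hPi] with d hd
    exact le_antisymm (hx ▸ hd.1.2) hd.1.1
  rcases hy.eq_or_lt with hy | hy
  · refine absurd (normalizedMI_nonpos_of_snd_const (y := L.y₀) ?_ hk hl hG)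
      (hv0.trans_lt hvG).not_ge
    filter_upwards [hPi] with d hd
    exact le_antisymm (hy ▸ hd.2.2) hd.2.1
  exact exists_mem_rangeGrids_gt hx hy hPi hc hk hl hG hvG

end Approximation

/-! ### Empirical measures and Hoeffding's inequality -/

/-- The empirical measure of a dataset. -/
noncomputable def empiricalMeasure {n : ℕ} (D : Fin n → ℝ × ℝ) : Measure (ℝ × ℝ) :=
  ENNReal.ofReal (n : ℝ)⁻¹ • ∑ t, Measure.dirac (D t)

section Empirical

variable {n : ℕ}

instance (D : Fin n → ℝ × ℝ) : IsFiniteMeasure (empiricalMeasure D) := by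
  rw [empiricalMeasure]
  exact Measure.smul_finite _ ENNReal.ofReal_ne_top

theorem empiricalMeasure_real_apply (D : Fin n → ℝ × ℝ) {A : Set (ℝ × ℝ)} (hA : MeasurableSet A) :
    (empiricalMeasure D).real A = (∑ t, A.indicator 1 (D t)) / n := by
  rw [empiricalMeasure, measureReal_ennreal_smul_apply, ENNReal.toReal_ofReal (by positivity),
    measureReal_def, Measure.finsetSum_apply, ENNReal.toReal_sum fun _ _ => measure_ne_top _ _,
    div_eq_inv_mul]
  congr 1
  refine Finset.sum_congr rfl fun t _ => ?_
  rw [Measure.dirac_apply' _ hA]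
  by_cases h : D t ∈ A <;> simp [h]

/-- Equality fails only for `n = 0`, where the empirical measure is zero. -/
theorem empiricalMeasure_real_univ_le (D : Fin n → ℝ × ℝ) :
    (empiricalMeasure D).real Set.univ ≤ 1 := by
  rw [empiricalMeasure_real_apply D MeasurableSet.univ]
  simp [div_self_le_one]

theorem countMatrix_eq_probMatrix {k l : ℕ} {G : Grid k l} (hG : G.IsDisjoint)
    (D : Fin n → ℝ × ℝ) : countMatrix D G = probMatrix (empiricalMeasure D) G := by
  classical
  funext i j
  rw [countMatrix, probMatrix, empiricalMeasure_real_apply D (hG.measurableSet_cell i j),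
    Set.ncard_eq_toFinset_card', Finset.card_eq_sum_ones, Nat.cast_sum]
  congr 1
  rw [Set.toFinset_ofPred, Finset.sum_filter]
  refine Finset.sum_congr rfl fun t _ => ?_
  simp [Set.indicator_apply, Set.mem_prod]

theorem hoeffding_indicator {Pi : Measure (ℝ × ℝ)} [IsProbabilityMeasure Pi] (hn : 0 < n)
    {A : Set (ℝ × ℝ)} (hA : MeasurableSet A) {t : ℝ} (ht : 0 ≤ t) :
    (Measure.pi fun _ : Fin n => Pi).real {D | t ≤ |(empiricalMeasure D).real A - Pi.real A|} ≤
      2 * Real.exp (-2 * n * t ^ 2) := by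
  have hn' : (0 : ℝ) < n := by exact_mod_cast hn
  set ν := Measure.pi fun _ : Fin n => Pi
  set f : ℝ × ℝ → ℝ := A.indicator 1 with hf
  have hfm : Measurable f := measurable_one.indicator hA
  -- Hoeffding's lemma: a centred variable with range of length `1` has variance proxy `1 / 4`.
  have hsub : HasSubgaussianMGF (fun d => f d - Pi.real A) ((1 / 2) ^ 2) Pi := by
    have h := hasSubgaussianMGF_of_mem_Icc (μ := Pi) (a := 0) (b := 1) hfm.aemeasurable
      (Eventually.of_forall fun d => by
        by_cases h : d ∈ A <;> simp [hf, h])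
    simpa [hf, integral_indicator_one hA] using h
  have hcoord : ∀ i : Fin n,
      HasSubgaussianMGF (fun D : Fin n → ℝ × ℝ => f (D i) - Pi.real A) ((1 / 2) ^ 2) ν := by
    intro i
    have h := measurePreserving_eval (fun _ : Fin n => Pi) i
    exact HasSubgaussianMGF.of_map (Y := Function.eval i) (X := fun d => f d - Pi.real A)
      h.measurable.aemeasurable (by rwa [h.map_eq])
  have hind : iIndepFun (fun (i : Fin n) (D : Fin n → ℝ × ℝ) => f (D i) - Pi.real A) ν :=
    iIndepFun_pi (X := fun _ d => f d - Pi.real A) fun _ => (hfm.sub_const _).aemeasurable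
  have hind' : iIndepFun (fun (i : Fin n) (D : Fin n → ℝ × ℝ) => -(f (D i) - Pi.real A)) ν :=
    iIndepFun_pi (X := fun _ d => -(f d - Pi.real A)) fun _ => (hfm.sub_const _).neg.aemeasurable
  have hexp : -(n * t) ^ 2 / (2 * ∑ _i : Fin n, (((1 / 2) ^ 2 : NNReal) : ℝ)) =
      -2 * n * t ^ 2 := by
    simp only [Finset.sum_const, Finset.card_univ, Fintype.card_fin, nsmul_eq_mul]
    push_cast
    field_simp
  have h1 := HasSubgaussianMGF.measure_sum_ge_le_of_iIndepFun hind (s := Finset.univ)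
    (fun i _ => hcoord i) (ε := n * t) (by positivity)
  have h2 := HasSubgaussianMGF.measure_sum_ge_le_of_iIndepFun hind' (s := Finset.univ)
    (fun i _ => (hcoord i).neg) (ε := n * t) (by positivity)
  push_cast at h1 h2 hexp
  rw [hexp] at h1 h2
  refine (measureReal_mono ?_).trans ((measureReal_union_le _ _).trans
    ((add_le_add h1 h2).trans_eq (two_mul _).symm))
  intro D hD
  rw [Set.mem_ofPred_eq, empiricalMeasure_real_apply D hA] at hD
  have hS : ∑ i, (f (D i) - Pi.real A) = n * ((∑ i, f (D i)) / n - Pi.real A) := by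
    rw [Finset.sum_sub_distrib]
    simp only [Finset.sum_const, Finset.card_univ, Fintype.card_fin, nsmul_eq_mul]
    field_simp
  rcases le_abs.1 hD with h | h
  · left
    rw [Set.mem_ofPred_eq, hS]
    exact mul_le_mul_of_nonneg_left h hn'.le
  · right
    rw [Set.mem_ofPred_eq, Finset.sum_neg_distrib, hS, ← mul_neg]
    exact mul_le_mul_of_nonneg_left h hn'.le

theorem measurable_empiricalMeasure_real {A : Set (ℝ × ℝ)} (hA : MeasurableSet A) :
    Measurable fun D : Fin n → ℝ × ℝ => (empiricalMeasure D).real A := by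
  simp only [empiricalMeasure_real_apply _ hA]
  have : Measurable (A.indicator (1 : ℝ × ℝ → ℝ)) := measurable_one.indicator hA
  fun_prop

end Empirical

/-! ### Union bound over unions of cells -/

section Deviation

variable {Ω : Type*} [MeasurableSpace Ω] {μ : Measure Ω} {Pi : Measure (ℝ × ℝ)}
  [IsProbabilityMeasure Pi] {n : ℕ} {D : Ω → Fin n → ℝ × ℝ}

theorem measure_deviation_le (hD : HasLaw D (Measure.pi fun _ : Fin n => Pi) μ) (hn : 0 < n)
    {A : Set (ℝ × ℝ)} (hA : MeasurableSet A) {t : ℝ} (ht : 0 ≤ t) :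
    μ {ω | t ≤ |(empiricalMeasure (D ω)).real A - Pi.real A|} ≤
      ENNReal.ofReal (2 * Real.exp (-2 * n * t ^ 2)) := by
  have hmeas : MeasurableSet {d : Fin n → ℝ × ℝ |
      t ≤ |(empiricalMeasure d).real A - Pi.real A|} := by
    have := measurable_empiricalMeasure_real (n := n) hA
    exact measurableSet_le measurable_const (by fun_prop)
  rw [hD.measure_eq hmeas, ← ofReal_measureReal]
  exact ENNReal.ofReal_le_ofReal (hoeffding_indicator hn hA ht)

theorem measure_exists_deviation_le (hD : HasLaw D (Measure.pi fun _ : Fin n => Pi) μ) (hn : 0 < n)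
    {r s : ℕ} {G : Grid r s} (hG : G.IsDisjoint) {t : ℝ} (ht : 0 ≤ t) :
    μ {ω | ∃ A, t ≤ |(empiricalMeasure (D ω)).real (gridUnion G A) - Pi.real (gridUnion G A)|} ≤
      ENNReal.ofReal (2 ^ (r * s) * (2 * Real.exp (-2 * n * t ^ 2))) := by
  have : {ω | ∃ A, t ≤ |(empiricalMeasure (D ω)).real (gridUnion G A) -
      Pi.real (gridUnion G A)|} = ⋃ A, {ω | t ≤ |(empiricalMeasure (D ω)).real (gridUnion G A) -
      Pi.real (gridUnion G A)|} := by
    ext ω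
    simp
  rw [this]
  refine (measure_iUnion_fintype_le μ _).trans ((Finset.sum_le_sum fun A _ =>
    measure_deviation_le hD hn (hG.measurableSet_gridUnion A) ht).trans_eq ?_)
  rw [Finset.sum_const, Finset.card_univ, Fintype.card_finset, Fintype.card_prod, Fintype.card_fin,
    Fintype.card_fin, nsmul_eq_mul, ← ENNReal.ofReal_natCast, ← ENNReal.ofReal_mul (by positivity)]
  push_cast
  rfl

end Deviation

/-! ### Typical datasets and uniform control of the scores -/

/-- The empirical measure of `D` is `t`-close to `Pi` on all unions of cells of the `⌊c m⌋ × m` and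
`m × ⌊c m⌋` grids of range equipartitions with `m ≤ M`. -/
def IsTypical (L : Range) (c : ℝ) (Pi : Measure (ℝ × ℝ)) (M : ℕ) (t : ℝ) {n : ℕ}
    (D : Fin n → ℝ × ℝ) : Prop :=
  ∀ m ≤ M,
    (∀ A, |(empiricalMeasure D).real (gridUnion (equipartitionGrid L ⌊c * m⌋₊ m) A) -
      Pi.real (gridUnion (equipartitionGrid L ⌊c * m⌋₊ m) A)| < t) ∧
    ∀ A, |(empiricalMeasure D).real (gridUnion (equipartitionGrid L m ⌊c * m⌋₊) A) -
      Pi.real (gridUnion (equipartitionGrid L m ⌊c * m⌋₊) A)| < t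

section Typical

variable {Pi : Measure (ℝ × ℝ)} [IsProbabilityMeasure Pi] {n : ℕ} {L : Range} {c t : ℝ} {M : ℕ}

/-- The factor `4` is two tails times two orientations, `exp (c M²)` bounds the number of unions of
cells of one grid, and `exp (M²)` bounds the `M + 1` values of `m`. -/
theorem measure_not_isTypical_le {Ω : Type*} [MeasurableSpace Ω] {μ : Measure Ω}
    {D : Ω → Fin n → ℝ × ℝ} (hD : HasLaw D (Measure.pi fun _ : Fin n => Pi) μ) (hn : 0 < n)
    (hx : L.x₀ ≤ L.x₁) (hy : L.y₀ ≤ L.y₁) (hc : 0 < c) (ht : 0 ≤ t) :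
    μ {ω | ¬ IsTypical L c Pi M t (D ω)} ≤
      ENNReal.ofReal (4 * Real.exp ((1 + c) * M ^ 2 - 2 * n * t ^ 2)) := by
  have hsub : {ω | ¬ IsTypical L c Pi M t (D ω)} ⊆ ⋃ m ∈ Finset.range (M + 1),
      ({ω | ∃ A, t ≤ |(empiricalMeasure (D ω)).real
        (gridUnion (equipartitionGrid L ⌊c * m⌋₊ m) A) -
          Pi.real (gridUnion (equipartitionGrid L ⌊c * m⌋₊ m) A)|} ∪
      {ω | ∃ A, t ≤ |(empiricalMeasure (D ω)).real
        (gridUnion (equipartitionGrid L m ⌊c * m⌋₊) A) -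
          Pi.real (gridUnion (equipartitionGrid L m ⌊c * m⌋₊) A)|}) := by
    intro ω hω
    simp only [Set.mem_ofPred_eq, IsTypical] at hω
    push Not at hω
    obtain ⟨m, hm, h⟩ := hω
    refine Set.mem_iUnion₂.2 ⟨m, Finset.mem_range_succ_iff.2 hm, ?_⟩
    by_cases h1 : ∀ A, |(empiricalMeasure (D ω)).real
        (gridUnion (equipartitionGrid L ⌊c * m⌋₊ m) A) -
          Pi.real (gridUnion (equipartitionGrid L ⌊c * m⌋₊ m) A)| < t
    · exact Or.inr (h h1)
    · push Not at h1
      exact Or.inl h1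
  set e := Real.exp (-2 * n * t ^ 2) with he
  have hpow : ∀ m ∈ Finset.range (M + 1), (2 : ℝ) ^ (⌊c * m⌋₊ * m) ≤ Real.exp (c * M ^ 2) := by
    intro m hm
    have hm' : (m : ℝ) ≤ M := by exact_mod_cast Finset.mem_range_succ_iff.1 hm
    have h2 : (2 : ℝ) ≤ Real.exp 1 := by have := Real.add_one_le_exp (1 : ℝ); linarith
    refine (pow_le_pow_left₀ zero_le_two h2 _).trans ?_
    rw [← Real.exp_nat_mul, mul_one]
    refine Real.exp_le_exp.2 ?_
    push_cast
    have h3 : (⌊c * m⌋₊ : ℝ) ≤ c * m := Nat.floor_le (by positivity)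
    calc (⌊c * m⌋₊ : ℝ) * m ≤ c * m * m := by gcongr
      _ ≤ c * M * M := by gcongr
      _ = c * M ^ 2 := by ring
  refine (measure_mono hsub).trans ((measure_biUnion_finset_le _ _).trans ?_)
  have hterm : ∀ m ∈ Finset.range (M + 1), μ
      ({ω | ∃ A, t ≤ |(empiricalMeasure (D ω)).real
        (gridUnion (equipartitionGrid L ⌊c * m⌋₊ m) A) -
          Pi.real (gridUnion (equipartitionGrid L ⌊c * m⌋₊ m) A)|} ∪
      {ω | ∃ A, t ≤ |(empiricalMeasure (D ω)).real
        (gridUnion (equipartitionGrid L m ⌊c * m⌋₊) A) -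
          Pi.real (gridUnion (equipartitionGrid L m ⌊c * m⌋₊) A)|}) ≤
      ENNReal.ofReal (4 * Real.exp (c * M ^ 2) * e) := by
    intro m hm
    refine (measure_union_le _ _).trans ((add_le_add
      (measure_exists_deviation_le hD hn (isDisjoint_equipartitionGrid hx hy) ht)
      (measure_exists_deviation_le hD hn (isDisjoint_equipartitionGrid hx hy) ht)).trans ?_)
    rw [← ENNReal.ofReal_add (by positivity) (by positivity), mul_comm m]
    refine ENNReal.ofReal_le_ofReal ?_
    have := mul_le_mul_of_nonneg_right (hpow m hm) (Real.exp_pos (-2 * n * t ^ 2)).le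
    rw [← he] at this ⊢
    linarith
  refine (Finset.sum_le_sum hterm).trans ?_
  rw [Finset.sum_const, Finset.card_range, nsmul_eq_mul, ← ENNReal.ofReal_natCast,
    ← ENNReal.ofReal_mul (by positivity)]
  refine ENNReal.ofReal_le_ofReal ?_
  have hM : ((M + 1 : ℕ) : ℝ) ≤ Real.exp (M ^ 2) := by
    have h1 := Real.add_one_le_exp ((M : ℝ) ^ 2)
    have h2 : (M : ℝ) ≤ (M : ℝ) ^ 2 := by exact_mod_cast Nat.le_self_pow two_ne_zero M
    push_cast
    linarith
  have hexp : Real.exp ((1 + c) * M ^ 2 - 2 * n * t ^ 2) =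
      Real.exp (M ^ 2) * (Real.exp (c * M ^ 2) * e) := by
    rw [he, ← Real.exp_add, ← Real.exp_add]
    ring_nf
  rw [hexp]
  have := mul_le_mul_of_nonneg_right hM (show 0 ≤ Real.exp (c * M ^ 2) * e by positivity)
  linarith

/-- The entropy modulus is used with `K = n`. The `ℓ¹` distance `2t` enters three entropies, giving
`6t`; `k`, `l` and `k * l` are each at most `B`, giving `3B`; the normalizer is at least `1`. -/
theorem IsTypical.abs_sub_le {D : Fin n → ℝ × ℝ} (hD : IsTypical L c Pi M t D)
    (hx : L.x₀ ≤ L.x₁) (hy : L.y₀ ≤ L.y₁) (hn : 1 ≤ n) {B : ℝ} (hM : M = ⌊B⌋₊) {k l : ℕ}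
    (hk : 2 ≤ k) (hl : 2 ≤ l) (hB : (k : ℝ) * l ≤ B) {G : Grid k l}
    (hG : G ∈ rangeGrids L c k l) :
    |normalizedMI (countMatrix D G) - normalizedMI (probMatrix Pi G)| ≤
      (6 * t * (1 + Real.log n) + 3 * B / n) / Real.log 2 := by
  have hdisj := isDisjoint_of_mem_rangeGrids hx hy hG
  have hn' : (1 : ℝ) ≤ n := by exact_mod_cast hn
  have hk' : (2 : ℝ) ≤ k := by exact_mod_cast hk
  have hl' : (2 : ℝ) ≤ l := by exact_mod_cast hl
  have hkB : (k : ℝ) ≤ B := by nlinarith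
  have hlB : (l : ℝ) ≤ B := by nlinarith
  have hdev : ∀ S, |(empiricalMeasure D).real (gridUnion G S) - Pi.real (gridUnion G S)| ≤ t := by
    intro S
    have h := exists_gridUnion_eq_of_mem_rangeGrids hG S
    split_ifs at h
    · obtain ⟨A, hA⟩ := h
      rw [hA]
      exact ((hD l (hM ▸ Nat.le_floor hlB)).1 A).le
    · obtain ⟨A, hA⟩ := h
      rw [hA]
      exact ((hD k (hM ▸ Nat.le_floor hkB)).2 A).le
  have hMI := abs_mutualInfo_sub_le hn' (probMatrix (empiricalMeasure D) G) (probMatrix Pi G)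
    (probMatrix_nonneg _ G) ((hdisj.sum_probMatrix_le _).trans (empiricalMeasure_real_univ_le D))
    (probMatrix_nonneg _ G) ((hdisj.sum_probMatrix_le _).trans_eq probReal_univ)
    (hdisj.sum_abs_probMatrix_sub_le _ _ hdev)
  have hlog := one_le_logb_min hk hl
  rw [countMatrix_eq_probMatrix hdisj, normalizedMI, normalizedMI, ← sub_div, abs_div,
    abs_of_pos (zero_lt_one.trans_le hlog)]
  refine (div_le_self (abs_nonneg _) hlog).trans ?_
  rw [le_div_iff₀ (Real.log_pos one_lt_two)]
  refine hMI.trans (add_le_add (by linarith) ?_)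
  gcongr
  linarith

theorem rangeEntry_nonneg (hx : L.x₀ ≤ L.x₁) (hy : L.y₀ ≤ L.y₁) {k l : ℕ} (hk : 2 ≤ k)
    (hl : 2 ≤ l) (D : Fin n → ℝ × ℝ) : 0 ≤ rangeEntry L c D k l := by
  refine Real.sSup_nonneg fun _ ⟨G, hG, h⟩ => h ▸ ?_
  have hdisj := isDisjoint_of_mem_rangeGrids hx hy hG
  simp only [countMatrix_eq_probMatrix hdisj]
  exact normalizedMI_probMatrix_nonneg hk hl hdisj _ (empiricalMeasure_real_univ_le D)

theorem micr_nonneg (hx : L.x₀ ≤ L.x₁) (hy : L.y₀ ≤ L.y₁) (B : ℝ) (D : Fin n → ℝ × ℝ) :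
    0 ≤ micr L B c D :=
  Real.sSup_nonneg fun _ ⟨_, _, hk, hl, _, h⟩ => h ▸ rangeEntry_nonneg hx hy hk hl D

/-- Uniform closeness of the normalized mutual informations over the range grids, and one range
grid that nearly attains `MIC*`, determine `MICr` up to an error. -/
theorem abs_micr_sub_micStar_lt (hPi : ∀ᵐ d ∂Pi, d ∈ L.toSet) {B δ : ℝ} (hδ : 0 < δ)
    {D : Fin n → ℝ × ℝ}
    (hdev : ∀ k l : ℕ, 2 ≤ k → 2 ≤ l → (k : ℝ) * l ≤ B → ∀ G ∈ rangeGrids L c k l,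
      |normalizedMI (countMatrix D G) - normalizedMI (probMatrix Pi G)| ≤ δ / 2)
    (hlow : 0 ≤ micStar Pi - δ / 2 → ∃ k l : ℕ, 2 ≤ k ∧ 2 ≤ l ∧ (k : ℝ) * l ≤ B ∧
      ∃ G ∈ rangeGrids L c k l, micStar Pi - δ / 2 < normalizedMI (probMatrix Pi G)) :
    |micr L B c D - micStar Pi| < δ := by
  obtain ⟨hx, hy⟩ := range_nonempty hPi
  have h0 : 0 ≤ micStar Pi := micStar_nonneg
  have hup : ∀ k l : ℕ, 2 ≤ k → 2 ≤ l → (k : ℝ) * l ≤ B → ∀ G ∈ rangeGrids L c k l,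
      normalizedMI (countMatrix D G) ≤ micStar Pi + δ / 2 := by
    intro k l hk hl hB G hG
    have h1 := (abs_le.1 (hdev k l hk hl hB G hG)).2
    have h2 := normalizedMI_le_micStar_of_mem_rangeGrids hx hy hPi hk hl hG
    linarith
  have hentry : ∀ k l : ℕ, 2 ≤ k → 2 ≤ l → (k : ℝ) * l ≤ B →
      rangeEntry L c D k l ≤ micStar Pi + δ / 2 := fun k l hk hl hB =>
    Real.sSup_le (fun _ ⟨G, hG, h⟩ => h ▸ hup k l hk hl hB G hG) (by linarith)
  have hle : micr L B c D ≤ micStar Pi + δ / 2 :=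
    Real.sSup_le (fun _ ⟨k, l, hk, hl, hB, h⟩ => h ▸ hentry k l hk hl hB) (by linarith)
  rw [abs_lt]
  refine ⟨?_, by linarith⟩
  -- When `MIC*` is below `δ / 2`, nonnegativity of `MICr` already suffices, even if no grid is
  -- admissible.
  by_cases hneg : 0 ≤ micStar Pi - δ / 2
  · obtain ⟨k, l, hk, hl, hB, G, hG, hv⟩ := hlow hneg
    have h1 := (abs_le.1 (hdev k l hk hl hB G hG)).1
    have hb1 : BddAbove ((fun G => normalizedMI (countMatrix D G)) '' rangeGrids L c k l) :=
      ⟨micStar Pi + δ / 2, fun _ ⟨G, hG, h⟩ => h ▸ hup k l hk hl hB G hG⟩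
    have hb2 : BddAbove {v | ∃ k l : ℕ, 2 ≤ k ∧ 2 ≤ l ∧ (k : ℝ) * l ≤ B ∧
        v = rangeEntry L c D k l} :=
      ⟨micStar Pi + δ / 2, fun _ ⟨k, l, hk, hl, hB, h⟩ => h ▸ hentry k l hk hl hB⟩
    have h2 : normalizedMI (countMatrix D G) ≤ rangeEntry L c D k l :=
      le_csSup hb1 (Set.mem_image_of_mem _ hG)
    have h3 : rangeEntry L c D k l ≤ micr L B c D := le_csSup hb2 ⟨k, l, hk, hl, hB, rfl⟩
    linarith
  · have := micr_nonneg (c := c) hx hy B D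
    linarith

end Typical

/-! ### Laplace noise and truncation -/

section Noise

theorem tendsto_log_div_natCast : Tendsto (fun n : ℕ => Real.log n / n) atTop (𝓝 0) := by
  have h := (isLittleO_log_rpow_atTop (zero_lt_one (α := ℝ))).tendsto_div_nhds_zero
  simp only [Real.rpow_one] at h
  exact h.comp tendsto_natCast_atTop_atTop

theorem tendsto_noiseScale (ε : ℝ) : Tendsto (fun n : ℕ => noiseScale n ε) atTop (𝓝 0) := by
  have h1 := tendsto_log_div_natCast.const_mul (4 / Real.log 2)
  have h2 : Tendsto (fun n : ℕ => (6 : ℝ) / n) atTop (𝓝 0) :=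
    tendsto_const_div_atTop_nhds_zero_nat _
  have h3 := (h1.add h2).div_const ε
  rw [mul_zero, add_zero, zero_div] at h3
  refine h3.congr fun n => ?_
  rw [noiseScale, Real.logb]
  ring

theorem noiseScale_pos {ε : ℝ} (hε : 0 < ε) {n : ℕ} (hn : 4 ≤ n) : 0 < noiseScale n ε := by
  have hn' : (1 : ℝ) ≤ n := by exact_mod_cast (by omega : 1 ≤ n)
  have := Real.logb_nonneg one_lt_two hn'
  have : (0 : ℝ) < n := by linarith
  rw [noiseScale]
  positivity

theorem laplace_tail_le {b δ : ℝ} (hb : 0 < b) (hδ : 0 < δ) :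
    laplace b {x | δ ≤ |x|} ≤ ENNReal.ofReal (Real.exp (-δ / b)) := by
  have hmeas : MeasurableSet {x : ℝ | δ ≤ |x|} := measurableSet_le measurable_const (by fun_prop)
  have hab : -b⁻¹ < 0 := by simpa using hb
  have hba : 0 < b⁻¹ := by positivity
  have hset : {x : ℝ | δ ≤ |x|} ⊆ Set.Iic (-δ) ∪ Set.Ici δ := by
    intro x hx
    rcases le_abs.1 (show δ ≤ |x| from hx) with h | h
    · exact Or.inr h
    · exact Or.inl (show x ≤ -δ by linarith)
  have hright : ∫⁻ x in Set.Ici δ, ENNReal.ofReal (Real.exp (-|x| / b) / (2 * b)) =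
      ENNReal.ofReal (Real.exp (-δ / b) / 2) := by
    rw [setLIntegral_congr Ioi_ae_eq_Ici.symm, setLIntegral_congr_fun
      (g := fun x => ENNReal.ofReal (Real.exp (-b⁻¹ * x) / (2 * b))) measurableSet_Ioi,
      ← ofReal_integral_eq_lintegral_ofReal ((integrableOn_exp_mul_Ioi hab δ).div_const _)
        (Eventually.of_forall fun x => by positivity), integral_div, integral_exp_mul_Ioi hab]
    · congr 1
      rw [show -δ / b = -b⁻¹ * δ by ring]
      field_simp
    · intro x hx
      have hx0 : 0 ≤ x := hδ.le.trans (le_of_lt hx)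
      simp only [abs_of_nonneg hx0]
      congr 3
      ring
  have hleft : ∫⁻ x in Set.Iic (-δ), ENNReal.ofReal (Real.exp (-|x| / b) / (2 * b)) =
      ENNReal.ofReal (Real.exp (-δ / b) / 2) := by
    rw [setLIntegral_congr_fun
      (g := fun x => ENNReal.ofReal (Real.exp (b⁻¹ * x) / (2 * b))) measurableSet_Iic,
      ← ofReal_integral_eq_lintegral_ofReal ((integrableOn_exp_mul_Iic hba (-δ)).div_const _)
        (Eventually.of_forall fun x => by positivity), integral_div, integral_exp_mul_Iic hba]
    · congr 1
      rw [show -δ / b = b⁻¹ * -δ by ring]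
      field_simp
    · intro x hx
      have hx0 : x ≤ 0 := (show x ≤ -δ from hx).trans (by linarith)
      simp only [abs_of_nonpos hx0]
      congr 3
      ring
  rw [laplace, withDensity_apply _ hmeas]
  refine (lintegral_mono_set hset).trans ((lintegral_union_le _ _ _).trans_eq ?_)
  rw [hleft, hright, ← ENNReal.ofReal_add (by positivity) (by positivity), add_halves]

theorem tendsto_measure_noise {ε : ℝ} (hε : 0 < ε) {Ω : Type*} [MeasurableSpace Ω] {μ : Measure Ω}
    {Z : ℕ → Ω → ℝ} (hZ : ∀ n, 4 ≤ n → HasLaw (Z n) (laplace (noiseScale n ε)) μ) {δ : ℝ}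
    (hδ : 0 < δ) : Tendsto (fun n => μ {ω | δ ≤ |Z n ω|}) atTop (𝓝 0) := by
  have hlim : Tendsto (fun n : ℕ => ENNReal.ofReal (Real.exp (-δ / noiseScale n ε))) atTop
      (𝓝 0) := by
    rw [← ENNReal.ofReal_zero]
    refine ENNReal.tendsto_ofReal (Real.tendsto_exp_atBot.comp ?_)
    have h : Tendsto (fun n : ℕ => noiseScale n ε) atTop (𝓝[>] 0) :=
      tendsto_nhdsWithin_iff.2 ⟨tendsto_noiseScale ε, (eventually_ge_atTop 4).mono fun n hn =>
        noiseScale_pos hε hn⟩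
    exact h.inv_tendsto_nhdsGT_zero.const_mul_atTop_of_neg (neg_neg_of_pos hδ)
  refine tendsto_of_tendsto_of_tendsto_of_le_of_le' tendsto_const_nhds hlim
    (Eventually.of_forall fun _ => zero_le) ?_
  filter_upwards [eventually_ge_atTop 4] with n hn
  rw [(hZ n hn).measure_eq (measurableSet_le measurable_const (by fun_prop))]
  exact laplace_tail_le (noiseScale_pos hε hn) hδ

/-- Clamping is `1`-Lipschitz and fixes the points of `[0, 1]`. -/
theorem abs_truncate_sub_le (x : ℝ) {y : ℝ} (hy0 : 0 ≤ y) (hy1 : y ≤ 1) :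
    |truncate x - y| ≤ |x - y| := by
  rw [truncate]
  have h : max 0 (min 1 y) = y := by rw [min_eq_right hy1, max_eq_right hy0]
  calc |max 0 (min 1 x) - y| = |max 0 (min 1 x) - max 0 (min 1 y)| := by rw [h]
    _ ≤ |min 1 x - min 1 y| := by
      simpa using abs_max_sub_max_le_max 0 (min 1 x) 0 (min 1 y)
    _ ≤ |x - y| := by simpa using abs_min_sub_min_le_max 1 x 1 y

end Noise

/-! ### Growth rates -/

section Rates

variable {α : ℝ} {B : ℕ → ℝ}

theorem tendsto_natCast_rpow_neg_mul_log {s : ℝ} (hs : 0 < s) :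
    Tendsto (fun n : ℕ => (n : ℝ) ^ (-s) * (1 + Real.log n)) atTop (𝓝 0) := by
  have h1 : Tendsto (fun x : ℝ => x ^ (-s)) atTop (𝓝 0) := tendsto_rpow_neg_atTop hs
  have h2 := (isLittleO_log_rpow_atTop hs).tendsto_div_nhds_zero
  have h3 := h1.add h2
  rw [add_zero] at h3
  refine (h3.comp tendsto_natCast_atTop_atTop).congr' ?_
  filter_upwards [eventually_gt_atTop 0] with n hn
  have hn' : (0 : ℝ) < n := by exact_mod_cast hn
  simp only [Function.comp_apply]
  rw [Real.rpow_neg hn'.le]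
  ring

theorem tendsto_div_of_isBigO_rpow (hα : α < 1)
    (hBα : B =O[atTop] fun n : ℕ => (n : ℝ) ^ α) :
    Tendsto (fun n : ℕ => B n / n) atTop (𝓝 0) := by
  have h : (fun n : ℕ => (n : ℝ) ^ α) =o[atTop] fun n : ℕ => (n : ℝ) := by
    refine (isLittleO_iff_tendsto' ((eventually_gt_atTop 0).mono fun n hn h => ?_)).2 ?_
    · exact absurd h (by exact_mod_cast hn.ne')
    · refine ((tendsto_rpow_neg_atTop (sub_pos.2 hα)).comp tendsto_natCast_atTop_atTop).congr' ?_
      filter_upwards [eventually_gt_atTop 0] with n hn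
      have hn' : (0 : ℝ) < n := by exact_mod_cast hn
      rw [Function.comp_apply, neg_sub, Real.rpow_sub hn', Real.rpow_one]
  exact (hBα.trans_isLittleO h).tendsto_div_nhds_zero

/-- With `t = n ^ (-(1/2 - α)/2)`, `n t²` equals `n ^ (1/2 + α)`, which dominates `B² = O(n ^ (2α))`
by the factor `n ^ (1/2 - α)`. -/
theorem tendsto_deviation_exponent (hα₁ : α < 1 / 2) (hα₀ : 0 < α) (c : ℝ) (hc : 0 < c)
    (hBα : B =O[atTop] fun n : ℕ => (n : ℝ) ^ α) :
    Tendsto (fun n : ℕ => (1 + c) * (⌊B n⌋₊ : ℝ) ^ 2 -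
      2 * n * ((n : ℝ) ^ (-((1 / 2 - α) / 2))) ^ 2) atTop atBot := by
  obtain ⟨K, hK0, hK⟩ := hBα.exists_pos
  have hsmall : Tendsto (fun n : ℕ => (1 + c) * K ^ 2 * (n : ℝ) ^ (-(1 / 2 - α))) atTop
      (𝓝 0) := by
    have := ((tendsto_rpow_neg_atTop (show 0 < 1 / 2 - α by linarith)).comp
      tendsto_natCast_atTop_atTop).const_mul ((1 + c) * K ^ 2)
    rwa [mul_zero] at this
  have hbig : Tendsto (fun n : ℕ => -(n : ℝ) ^ (1 / 2 + α)) atTop atBot :=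
    tendsto_neg_atTop_atBot.comp
      ((tendsto_rpow_atTop (by linarith)).comp tendsto_natCast_atTop_atTop)
  refine tendsto_atBot_mono' _ ?_ hbig
  filter_upwards [hK.bound, hsmall.eventually_le_const one_pos, eventually_gt_atTop 0]
    with n hn1 hn2 hn3
  have hn' : (0 : ℝ) < n := by exact_mod_cast hn3
  have hfl : (⌊B n⌋₊ : ℝ) ≤ K * (n : ℝ) ^ α := by
    rw [Real.norm_eq_abs, Real.norm_eq_abs, abs_of_pos (Real.rpow_pos_of_pos hn' α)] at hn1
    rcases le_total 0 (B n) with h | h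
    · exact (Nat.floor_le h).trans ((le_abs_self _).trans hn1)
    · rw [Nat.floor_of_nonpos h, Nat.cast_zero]
      positivity
  have hsq : (⌊B n⌋₊ : ℝ) ^ 2 ≤ (K * (n : ℝ) ^ α) ^ 2 := by gcongr
  have e1 : ((n : ℝ) ^ α) ^ 2 = (n : ℝ) ^ (-(1 / 2 - α)) * (n : ℝ) ^ (1 / 2 + α) := by
    rw [← Real.rpow_add hn', ← Real.rpow_mul_natCast hn'.le]
    congr 1
    push_cast
    ring
  have e2 : n * ((n : ℝ) ^ (-((1 / 2 - α) / 2))) ^ 2 = (n : ℝ) ^ (1 / 2 + α) := by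
    rw [← Real.rpow_mul_natCast hn'.le]
    nth_rewrite 1 [← Real.rpow_one (n : ℝ)]
    rw [← Real.rpow_add hn']
    congr 1
    push_cast
    ring
  have hpos : 0 < (n : ℝ) ^ (1 / 2 + α) := Real.rpow_pos_of_pos hn' _
  have h1 := mul_le_mul_of_nonneg_left hsq (show 0 ≤ 1 + c by linarith)
  rw [mul_pow, e1] at h1
  have h2 := mul_le_mul_of_nonneg_right hn2 hpos.le
  rw [mul_assoc 2, e2]
  nlinarith

end Rates

/-! ### Consistency -/

theorem tendstoInMeasure_micr {L : Range} {c α : ℝ} (hc : 0 < c) (hα₀ : 0 < α) (hα₁ : α < 1 / 2)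
    {B : ℕ → ℝ} (hB : Tendsto B atTop atTop) (hBα : B =O[atTop] fun n : ℕ => (n : ℝ) ^ α)
    {Pi : Measure (ℝ × ℝ)} [IsProbabilityMeasure Pi] (hPi : ∀ᵐ d ∂Pi, d ∈ L.toSet)
    {Ω : Type*} [MeasurableSpace Ω] {μ : Measure Ω} {D : ∀ n : ℕ, Ω → Fin n → ℝ × ℝ}
    (hD : ∀ n, HasLaw (D n) (Measure.pi fun _ : Fin n => Pi) μ) :
    TendstoInMeasure μ (fun n ω => micr L (B n) c (D n ω)) atTop (fun _ => micStar Pi) := by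
  obtain ⟨hx, hy⟩ := range_nonempty hPi
  rw [tendstoInMeasure_iff_dist]
  intro δ hδ
  -- Small enough that `t log n → 0`, yet large enough that `n t²` outgrows `B²`.
  set t : ℕ → ℝ := fun n => (n : ℝ) ^ (-((1 / 2 - α) / 2)) with ht
  have ht0 : ∀ n, 0 ≤ t n := fun n => Real.rpow_nonneg (Nat.cast_nonneg n) _
  have hbad : Tendsto (fun n : ℕ => ENNReal.ofReal
      (4 * Real.exp ((1 + c) * (⌊B n⌋₊ : ℝ) ^ 2 - 2 * n * t n ^ 2))) atTop (𝓝 0) := by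
    have := (Real.tendsto_exp_atBot.comp
      (tendsto_deviation_exponent hα₁ hα₀ c hc hBα)).const_mul 4
    rw [mul_zero] at this
    rw [← ENNReal.ofReal_zero]
    exact ENNReal.tendsto_ofReal this
  have herr : Tendsto (fun n : ℕ => (6 * t n * (1 + Real.log n) + 3 * B n / n) / Real.log 2)
      atTop (𝓝 0) := by
    have h := (((tendsto_natCast_rpow_neg_mul_log (show 0 < (1 / 2 - α) / 2 by
      linarith)).const_mul 6).add ((tendsto_div_of_isBigO_rpow (by linarith) hBα).const_mul
        3)).div_const (Real.log 2)
    rw [mul_zero, mul_zero, add_zero, zero_div] at h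
    refine h.congr fun n => ?_
    rw [ht]
    ring
  have hlow : ∀ᶠ n in atTop, 0 ≤ micStar Pi - δ / 2 → ∃ k l : ℕ, 2 ≤ k ∧ 2 ≤ l ∧
      (k : ℝ) * l ≤ B n ∧ ∃ G ∈ rangeGrids L c k l,
        micStar Pi - δ / 2 < normalizedMI (probMatrix Pi G) := by
    by_cases h0 : 0 ≤ micStar Pi - δ / 2
    · obtain ⟨k, l, hk, hl, h⟩ := exists_mem_rangeGrids_gt_of_lt_micStar hPi hc h0 (by linarith)
      filter_upwards [hB.eventually_ge_atTop ((k : ℝ) * l)] with n hn _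
      exact ⟨k, l, hk, hl, hn, h⟩
    · exact Eventually.of_forall fun n h => absurd h h0
  refine tendsto_of_tendsto_of_tendsto_of_le_of_le' tendsto_const_nhds hbad
    (Eventually.of_forall fun _ => zero_le) ?_
  filter_upwards [eventually_ge_atTop 1, herr.eventually_le_const (half_pos hδ), hlow]
    with n hn hnerr hnlow
  refine (measure_mono fun ω hω htyp => ?_).trans
    (measure_not_isTypical_le (M := ⌊B n⌋₊) (hD n) hn hx hy hc (ht0 n))
  refine (show δ ≤ dist _ _ from hω).not_gt ?_
  rw [Real.dist_eq]
  exact abs_micr_sub_micStar_lt hPi hδ (fun k l hk hl hkl G hG =>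
    (htyp.abs_sub_le hx hy hn rfl hk hl hkl hG).trans hnerr) hnlow

theorem tendstoInMeasure_micrLap {L : Range} {c ε : ℝ} (hε : 0 < ε) {B : ℕ → ℝ}
    {Pi : Measure (ℝ × ℝ)} [IsProbabilityMeasure Pi] {Ω : Type*} [MeasurableSpace Ω]
    {μ : Measure Ω} {D : ∀ n : ℕ, Ω → Fin n → ℝ × ℝ}
    (hD : TendstoInMeasure μ (fun n ω => micr L (B n) c (D n ω)) atTop (fun _ => micStar Pi))
    {Z : ℕ → Ω → ℝ} (hZ : ∀ n, 4 ≤ n → HasLaw (Z n) (laplace (noiseScale n ε)) μ) :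
    TendstoInMeasure μ (fun n ω => micrLap L (B n) c (D n ω) (Z n ω)) atTop
      (fun _ => micStar Pi) := by
  rw [tendstoInMeasure_iff_dist] at hD ⊢
  intro δ hδ
  -- An error of `δ` forces either the estimate without noise or the noise itself to be off by at
  -- least `δ / 2`.
  have h := (hD _ (half_pos hδ)).add (tendsto_measure_noise hε hZ (half_pos hδ))
  rw [add_zero] at h
  refine tendsto_of_tendsto_of_tendsto_of_le_of_le tendsto_const_nhds h (fun _ => zero_le)
    fun n => (measure_mono fun ω hω => ?_).trans (measure_union_le _ _)
  by_contra hcon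
  rw [Set.mem_union, not_or] at hcon
  have h1 := not_le.1 (show ¬ δ / 2 ≤ dist _ _ from hcon.1)
  have h2 := not_le.1 (show ¬ δ / 2 ≤ |Z n ω| from hcon.2)
  refine (show δ ≤ dist _ _ from hω).not_gt ?_
  rw [Real.dist_eq] at h1 ⊢
  rw [micrLap]
  have h3 := abs_truncate_sub_le (micr L (B n) c (D n ω) + Z n ω) (micStar_nonneg (Pi := Pi))
    micStar_le_one
  rw [add_sub_right_comm] at h3
  linarith [abs_add_le (micr L (B n) c (D n ω) - micStar Pi) (Z n ω)]

end MICr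

theorem mainTheorem10
    (L : MICr.Range) (c ε α : ℝ) (hc : 0 < c) (hε : 0 < ε) (hα₀ : 0 < α) (hα₁ : α < 1 / 2)
    (B : ℕ → ℝ) (hB : Tendsto B atTop atTop)
    (hBα : B =O[atTop] fun n : ℕ => (n : ℝ) ^ α) :
    Tendsto (fun n : ℕ => MICr.noiseScale n ε) atTop (𝓝 0) ∧
    ∀ (Pi : Measure (ℝ × ℝ)) [IsProbabilityMeasure Pi], (∀ᵐ d ∂Pi, d ∈ L.toSet) →
      ∀ {Ω : Type*} [MeasurableSpace Ω] (μ : Measure Ω) [IsProbabilityMeasure μ]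
        (D : ∀ n : ℕ, Ω → Fin n → ℝ × ℝ),
        (∀ n, HasLaw (D n) (Measure.pi fun _ : Fin n => Pi) μ) →
        TendstoInMeasure μ (fun n ω => MICr.micr L (B n) c (D n ω)) atTop
          (fun _ => MICr.micStar Pi) ∧
        ∀ Z : ℕ → Ω → ℝ,
          (∀ n, 4 ≤ n → HasLaw (Z n) (MICr.laplace (MICr.noiseScale n ε)) μ) →
          (∀ n, 4 ≤ n → IndepFun (D n) (Z n) μ) →
          TendstoInMeasure μ (fun n ω => MICr.micrLap L (B n) c (D n ω) (Z n ω)) atTop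
            (fun _ => MICr.micStar Pi) := by
  exact ⟨MICr.tendsto_noiseScale ε, fun Pi _ hPi Ω _ μ _ D hD =>
    ⟨MICr.tendstoInMeasure_micr hc hα₀ hα₁ hB hBα hPi hD, fun Z hZ _ =>
      MICr.tendstoInMeasure_micrLap hε (MICr.tendstoInMeasure_micr hc hα₀ hα₁ hB hBα hPi hD) hZ⟩⟩
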